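/- Let $G$ be a finite simple graph on a vertex set $V$ whose stability number $\alpha(G)$ (the largest cardinality of a stable set, i.e. of a set of pairwise non-adjacent vertices) equals $2$, let $\overline{G}$ be its complement, and let $K$ be a field. For $W\subseteq V$ put $\rho(W)=\sum_{j\in W}\mathbf{e}_j\in\mathbb{R}^V$. The stable set polytope $\mathcal{Q}_G\subset\mathbb{R}^V$ is the convex hull of the vectors $\rho(W)$, $W$ a stable set of $G$ (including $\emptyset$); the edge polytope $\mathcal{P}_H\subset\mathbb{R}^V$ of a simple graph $H$ on $V$ is the convex hull of the vectors $\mathbf{e}_i+\mathbf{e}_j$, $\{i,j\}$ an edge of $H$. For an integral convex polytope $\mathcal{P}\subset\mathbb{R}^V$, the toric ring $K[\mathcal{P}]$ is the $K$-subalgebra of $K[x_v^{\pm1}\ (v\in V),\,t]$ generated by the monomials $X^{\mathbf{a}}t$, $\mathbf{a}\in\mathcal{P}\cap\mathbb{Z}^V$. The polytope $\mathcal{P}$ is normal if the domain $K[\mathcal{P}]$ is integrally closed in its field of fractions. It has a unimodular covering if it is the union of finitely many unimodular simplices with vertices in $\mathcal{P}\cap\mathbb{Z}^V$, where a simplex with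 such vertices is unimodular if its vertices generate the same affine lattice as $\mathcal{P}\cap\mathbb{Z}^V$ (for $\mathcal{Q}_G$, whose lattice points generate $\mathbb{Z}^V$: full-dimensional simplices of normalized volume $1$). A hole is an induced cycle of length greater than $3$; it is odd if its length is odd. A bridge of two cycles $C_1,C_2$ of a graph is an edge $\{i,j\}$ of the graph with $i$ a vertex of $C_1$ not in $C_2$ and $j$ a vertex of $C_2$ not in $C_1$. A simple graph satisfies the odd cycle condition if any two of its induced odd cycles (of length at least $3$) have a common vertex or a bridge. Then the following conditions are equivalent: (i) $\mathcal{Q}_G$ is normal; (ii) $\mathcal{Q}_G$ has a unimodular covering; (iii) $\overline{G}$ satisfies the odd cycle condition, or, equivalently for this $G$: any two odd holes of $\overline{G}$ without common vertices have a bridge in $\overline{G}$. In particular, if $\mathcal{Q}_G$ is normal, then $\mathcal{P}_{\overline{G}}$ is normal. -/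

import Mathlib

namespace StabPoly

/-- The real point with the same coordinates as the integer vector `a`. -/
def toReal {V : Type*} (a : V → ℤ) : V → ℝ := fun v => (a v : ℝ)

/-- The integer points of a subset `P` of `ℝ^V`. -/
def latticePoints {V : Type*} (P : Set (V → ℝ)) : Set (V → ℤ) :=
  {a | toReal a ∈ P}

/-- The vector `ρ(W) = ∑_{j ∈ W} e_j` of a vertex set `W`. -/
noncomputable def rho {V : Type*} (W : Set V) : V → ℝ :=
  W.indicator (fun _ => (1 : ℝ))

/-- The stable set polytope of `G`: the convex hull of the vectors `ρ(W)`, `W` a stable set. -/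
noncomputable def stableSetPolytope {V : Type*} (G : SimpleGraph V) : Set (V → ℝ) :=
  convexHull ℝ {x | ∃ W : Set V, G.IsIndepSet W ∧ x = rho W}

/-- The edge polytope of a simple graph `G`: the convex hull of the vectors `e_i + e_j`,
`{i, j}` an edge. -/
noncomputable def edgePolytope {V : Type*} (G : SimpleGraph V) : Set (V → ℝ) :=
  convexHull ℝ {x | ∃ i j : V, G.Adj i j ∧ x = rho {i} + rho {j}}

/-- The toric ring `K[P]`: the subalgebra generated by the monomials `X^a t`, `a ∈ P ∩ ℤ^V`, of
`K[X, X⁻¹, t]`, the algebra whose monomials `X^a t^k` have exponents `(a, k) ∈ ℤ^V × ℕ`. -/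
noncomputable def toricRing {V : Type*} (K : Type*) [Field K] (P : Set (V → ℝ)) :
    Subalgebra K (AddMonoidAlgebra K ((V → ℤ) × ℕ)) :=
  Algebra.adjoin K
    ((fun a : V → ℤ => (AddMonoidAlgebra.single (a, 1) 1 : AddMonoidAlgebra K ((V → ℤ) × ℕ))) ''
      latticePoints P)

/-- `P` is normal (over `K`): its toric ring, which is a domain, is integrally closed in its
field of fractions. -/
def IsNormal {V : Type*} (K : Type*) [Field K] (P : Set (V → ℝ)) : Prop :=
  IsIntegrallyClosed (toricRing K P)

/-- The subgroup of `ℤ^V × ℤ` generated by the vectors `(a, 1)`, `a ∈ S`. -/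
def homLattice {V : Type*} (S : Set (V → ℤ)) : AddSubgroup ((V → ℤ) × ℤ) :=
  AddSubgroup.closure ((fun a : V → ℤ => (a, (1 : ℤ))) '' S)

/-- `S` is the vertex set of a unimodular simplex of `P`: its elements are affinely independent
lattice points of `P`, and they generate the same affine lattice as all lattice points of `P`,
so that the simplex has the dimension of `P` and normalized volume `1`. -/
structure IsUnimodularSimplex {V : Type*} (P : Set (V → ℝ)) (S : Finset (V → ℤ)) : Prop where
  subset : (S : Set (V → ℤ)) ⊆ latticePoints P
  affineIndependent : AffineIndependent ℝ (fun a : S => toReal (a : V → ℤ))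
  lattice_eq : homLattice (S : Set (V → ℤ)) = homLattice (latticePoints P)

/-- `P` is the union of finitely many unimodular simplices with vertices in `P ∩ ℤ^V`. -/
def HasUnimodularCovering {V : Type*} (P : Set (V → ℝ)) : Prop :=
  ∃ C : Finset (Finset (V → ℤ)),
    (∀ S ∈ C, IsUnimodularSimplex P S) ∧
      P = ⋃ S ∈ C, convexHull ℝ (toReal '' (S : Set (V → ℤ)))

/-- `s` is the vertex set of an induced odd cycle (of length at least three) of `H`. -/
def IsInducedOddCycle {V : Type*} (H : SimpleGraph V) (s : Set V) : Prop :=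
  ∃ k : ℕ, Odd k ∧ 3 ≤ k ∧ Nonempty (SimpleGraph.cycleGraph k ≃g H.induce s)

/-- `s` is the vertex set of an odd hole of `H`: an induced odd cycle of length greater
than three. -/
def IsOddHole {V : Type*} (H : SimpleGraph V) (s : Set V) : Prop :=
  ∃ k : ℕ, Odd k ∧ 3 < k ∧ Nonempty (SimpleGraph.cycleGraph k ≃g H.induce s)

/-- There is a bridge of two cycles of `H` with vertex sets `s` and `t`. -/
def HasBridge {V : Type*} (H : SimpleGraph V) (s t : Set V) : Prop :=
  ∃ i ∈ s \ t, ∃ j ∈ t \ s, H.Adj i j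

/-- The odd cycle condition: any two induced odd cycles have a common vertex or a bridge. -/
def OddCycleCondition {V : Type*} (H : SimpleGraph V) : Prop :=
  ∀ s t : Set V, IsInducedOddCycle H s → IsInducedOddCycle H t →
    (s ∩ t).Nonempty ∨ HasBridge H s t

/-- Any two odd holes without common vertices have a bridge. -/
def OddHoleCondition {V : Type*} (H : SimpleGraph V) : Prop :=
  ∀ s t : Set V, IsOddHole H s → IsOddHole H t → Disjoint s t → HasBridge H s t

end StabPoly

/-!
Let `H = Gᶜ`. As `α(G) = 2`, the graph `H` has no triangles, so its induced odd cycles are its odd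
holes, and the lattice points of the stable set polytope are `0`, the `e_v`, and the `e_v + e_w` for
edges `vw` of `H`. With an apex `none`, for which `eps none = 0`, these are the vectors
`eps u + eps w` for the edges of the cone over `H`, the apex carrying a loop: the toric ring is
the edge ring of this cone.

*Odd cycle condition implies unimodular covering* (`hasUnimodularCovering`). Among the lattice
simplices containing a given point, take one whose lattice is maximal. It spans all lattice points,
so, as a subgraph `T` of the cone, each of its components has an odd cycle
(`exists_odd_closed_walk`). If `T` is connected, it generates all of the lattice. Otherwise the
condition gives an edge `b` joining odd cycles of two components
(`exists_coneAdj_of_disjoint`), and `2 b` is the alternating sum of the edges of the two cycles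
(`IsInducedOddWalk.exists_coeff`). Exchanging `b` for an edge of these cycles keeps the point
covered and enlarges the lattice (`exists_exchange`), a contradiction. The induced cycles needed
here come from shortest odd closed walks (`exists_isInducedOddWalk`).

*Unimodular covering implies normality* (`HasUnimodularCovering.isNormal`). The toric ring lies in
a polynomial ring, which is integrally closed, so only polynomials integral over the toric ring
matter. A weight nonpositive on the toric ring is nonpositive on them
(`WeightLE.of_isIntegral`), so by separation of convex sets their exponents lie in the cone over
the polytope. There a unimodular simplex writes an exponent as a nonnegative integral combination of
lattice points.

*Normality implies the odd hole condition* (`oddHoleCondition_of_isNormal`). For two disjoint odd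
holes without a bridge, twice the vector `(ρ(C ∪ C'), (|C| + |C'|) / 2)` is the sum of the edges of
both cycles, but the vector itself is not a sum of edges, by parity.

The edge polytope of `H` is the face `∑ x = 2` of the stable set polytope, and the weight defining
this face shows that its toric ring is integrally closed in that of the larger polytope
(`isNormal_edgePolytope`).
-/

namespace StabPoly

/-! ### Odd closed walks of a symmetric relation -/

section Walks

variable {U : Type*} {R : U → U → Prop}

/-- There is a walk of length `n` from `u` to `w` along the relation `R`. Loops `R u u` are
allowed, and may be used as steps. -/
def HasWalk (R : U → U → Prop) (n : ℕ) (u w : U) : Prop :=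
  ∃ c : ℕ → U, c 0 = u ∧ c n = w ∧ ∀ i < n, R (c i) (c (i + 1))

theorem HasWalk.refl (u : U) : HasWalk R 0 u u :=
  ⟨fun _ => u, rfl, rfl, fun i hi => absurd hi (Nat.not_lt_zero i)⟩

theorem HasWalk.single {u w : U} (h : R u w) : HasWalk R 1 u w :=
  ⟨fun i => if i = 0 then u else w, by simp, by simp, fun i hi => by
    obtain rfl : i = 0 := by omega
    simpa using h⟩

theorem HasWalk.trans {n m : ℕ} {u w z : U} (h : HasWalk R n u w) (h' : HasWalk R m w z) :
    HasWalk R (n + m) u z := by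
  obtain ⟨c, hc0, hcn, hc⟩ := h
  obtain ⟨d, hd0, hdm, hd⟩ := h'
  refine ⟨fun i => if i ≤ n then c i else d (i - n), by simpa using hc0, ?_, fun i hi => ?_⟩
  · rcases Nat.eq_zero_or_pos m with rfl | hm
    · simp only [add_zero, le_refl, if_true]
      rw [hcn, ← hd0, hdm]
    · simp only [show ¬ n + m ≤ n by omega, if_false, Nat.add_sub_cancel_left, hdm]
  · rcases lt_trichotomy i n with h | h | h
    · simp only [h.le, if_true, show i + 1 ≤ n by omega]
      exact hc i h
    · subst h
      simp only [le_refl, if_true, show ¬ i + 1 ≤ i by omega, if_false, Nat.add_sub_cancel_left]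
      rw [hcn, ← hd0]
      exact hd 0 (by omega)
    · simp only [show ¬ i ≤ n by omega, show ¬ i + 1 ≤ n by omega, if_false]
      rw [show i + 1 - n = i - n + 1 by omega]
      exact hd _ (by omega)

theorem HasWalk.symm (hR : ∀ u w, R u w → R w u) {n : ℕ} {u w : U} (h : HasWalk R n u w) :
    HasWalk R n w u := by
  obtain ⟨c, hc0, hcn, hc⟩ := h
  refine ⟨fun i => c (n - i), by simpa using hcn, by simpa using hc0, fun i hi => ?_⟩
  have := hR _ _ (hc (n - (i + 1)) (by omega))
  rwa [show n - (i + 1) + 1 = n - i by omega] at this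

theorem hasWalk_segment {c : ℕ → U} {k : ℕ} (hc : ∀ i < k, R (c i) (c (i + 1))) {i j : ℕ}
    (hij : i ≤ j) (hj : j ≤ k) : HasWalk R (j - i) (c i) (c j) :=
  ⟨fun l => c (i + l), rfl, by simp only [Nat.add_sub_cancel' hij],
    fun l hl => hc (i + l) (by omega)⟩

/-- A component without odd closed walks is bipartite, and the signs of its two colours vanish
on every edge. -/
theorem exists_sign_of_forall_not_odd (hR : ∀ u w, R u w → R w u) (u : U)
    (h : ∀ k, Odd k → ¬ HasWalk R k u u) :
    ∃ f : U → ℤ, f u = 1 ∧ ∀ v w, R v w → f v + f w = 0 := by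
  classical
  have hexcl : ∀ w n m, Even n → Odd m → HasWalk R n u w → ¬ HasWalk R m u w :=
    fun w n m hn hm h1 h2 => h (n + m) (hn.add_odd hm) (h1.trans (h2.symm hR))
  refine ⟨fun w => if ∃ n, Even n ∧ HasWalk R n u w then 1 else
    if ∃ n, Odd n ∧ HasWalk R n u w then -1 else 0, ?_, fun v w hvw => ?_⟩
  · exact if_pos ⟨0, Even.zero, HasWalk.refl u⟩
  · have step : ∀ a b, R a b → ∀ n, HasWalk R n u a → HasWalk R (n + 1) u b :=
      fun a b hab n hn => hn.trans (HasWalk.single hab)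
    have e1 : ∀ a b, R a b → (∃ n, Even n ∧ HasWalk R n u a) → ∃ n, Odd n ∧ HasWalk R n u b :=
      fun a b hab ⟨n, hn, hw⟩ => ⟨n + 1, hn.add_one, step a b hab n hw⟩
    have e2 : ∀ a b, R a b → (∃ n, Odd n ∧ HasWalk R n u a) → ∃ n, Even n ∧ HasWalk R n u b :=
      fun a b hab ⟨n, hn, hw⟩ => ⟨n + 1, hn.add_one, step a b hab n hw⟩
    have ex : ∀ a, (∃ n, Even n ∧ HasWalk R n u a) → ¬ ∃ n, Odd n ∧ HasWalk R n u a :=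
      fun a ⟨n, hn, hw⟩ ⟨m, hm, hw'⟩ => hexcl a n m hn hm hw hw'
    have hwv := hR _ _ hvw
    beta_reduce
    by_cases hv : ∃ n, Even n ∧ HasWalk R n u v
    · have hw := e1 v w hvw hv
      rw [if_pos hv, if_neg fun h' => ex w h' hw, if_pos hw]
      rfl
    · by_cases hv' : ∃ n, Odd n ∧ HasWalk R n u v
      · rw [if_neg hv, if_pos hv', if_pos (e2 v w hvw hv')]
        rfl
      · rw [if_neg hv, if_neg hv', if_neg fun h' => hv' (e1 w v hwv h'),
          if_neg fun h' => hv (e2 w v hwv h')]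
        rfl

/-- `c` runs periodically, with period `k`, through an induced odd cycle of `R`; for `k = 1` it
stays at a loop. -/
structure IsInducedOddWalk (R : U → U → Prop) (k : ℕ) (c : ℕ → U) : Prop where
  odd : Odd k
  step : ∀ i, R (c i) (c (i + 1))
  periodic : ∀ i, c (i + k) = c i
  inj : ∀ i j, c i = c j → i ≡ j [MOD k]
  chordless : ∀ i j, R (c i) (c j) → j ≡ i + 1 [MOD k] ∨ i ≡ j + 1 [MOD k]

/-- A shortest odd closed walk in a component is an induced cycle: a repeated vertex or a chord
would split off a shorter odd closed walk. -/
theorem exists_isInducedOddWalk (hR : ∀ u w, R u w → R w u) {u : U} {k : ℕ} (hk : Odd k)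
    (h : HasWalk R k u u) :
    ∃ k c, IsInducedOddWalk R k c ∧ ∀ i, ∃ n, HasWalk R n u (c i) := by
  classical
  have hex : ∃ k, Odd k ∧ ∃ w, (∃ n, HasWalk R n u w) ∧ HasWalk R k w w :=
    ⟨k, hk, u, ⟨0, HasWalk.refl u⟩, h⟩
  obtain ⟨hodd, w, ⟨m, hm⟩, c, hc0, hck, hc⟩ := Nat.find_spec hex
  have hmin : ∀ l, Odd l → ∀ w, (∃ n, HasWalk R n u w) → HasWalk R l w w → Nat.find hex ≤ l :=
    fun l hl w hw hlw => Nat.find_min' hex ⟨hl, w, hw, hlw⟩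
  generalize Nat.find hex = k at *
  have hkpos : 0 < k := hodd.pos
  have hreach : ∀ i ≤ k, ∃ n, HasWalk R n u (c i) := fun i hi => by
    have := hasWalk_segment hc (Nat.zero_le i) hi
    rw [hc0] at this
    exact ⟨_, hm.trans this⟩
  -- A repeated vertex cuts the cycle into two shorter closed walks, one of which is odd.
  have hinj : ∀ i j, i < j → j < k → c i ≠ c j := by
    intro i j hij hj he
    have w1 := hasWalk_segment hc hij.le hj.le
    rw [← he] at w1
    have w2 := hasWalk_segment hc hj.le le_rfl
    have w3 := hasWalk_segment hc (Nat.zero_le i) (hij.le.trans hj.le)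
    rw [hck, ← hc0, ← he] at w2
    have w4 := w2.trans w3
    rcases Nat.even_or_odd (j - i) with hp | hp
    · have := hmin _ (by grind) _ (hreach i (by omega)) w4
      omega
    · have := hmin _ hp _ (hreach i (by omega)) w1
      omega
  -- A chord `c i, c j` cuts the cycle into two closed walks of total length `k + 2`, so one of
  -- them is odd. The case `i = j`, a loop, gives `k = 1`.
  have hchord : ∀ i j, i ≤ j → j < k → R (c i) (c j) → j = i + 1 ∨ (i = 0 ∧ j + 1 = k) := by
    intro i j hij hj he
    have w1 := (hasWalk_segment hc hij hj.le).trans (HasWalk.single (hR _ _ he))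
    have w2 := hasWalk_segment hc hj.le le_rfl
    have w3 := hasWalk_segment hc (Nat.zero_le i) (hij.trans hj.le)
    rw [hck, ← hc0] at w2
    have w4 := (w2.trans w3).trans (HasWalk.single he)
    rcases Nat.even_or_odd (j - i) with hp | hp
    · have := hmin _ (by grind) _ (hreach i (by omega)) w1
      omega
    · have := hmin _ (by grind) _ (hreach j (by omega)) w4
      grind
  refine ⟨k, fun i => c (i % k), ⟨hodd, fun i => ?_, fun i => ?_, fun i j hij => ?_,
    fun i j hij => ?_⟩, fun i => hreach _ (Nat.mod_lt i hkpos).le⟩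
  · have hi := Nat.mod_lt i hkpos
    have h1 := hc _ hi
    rcases Nat.lt_or_ge (i % k + 1) k with h2 | h2
    · have : (i + 1) % k = i % k + 1 := by
        rw [← Nat.mod_add_mod, Nat.mod_eq_of_lt h2]
      rwa [this]
    · have h3 : i % k + 1 = k := by omega
      have : (i + 1) % k = 0 := by
        rw [← Nat.mod_add_mod, h3, Nat.mod_self]
      rw [this, hc0]
      rwa [h3, hck] at h1
  · simp
  · have hi := Nat.mod_lt i hkpos
    have hj := Nat.mod_lt j hkpos
    by_contra hne
    rcases lt_or_gt_of_ne hne with h1 | h1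
    · exact hinj _ _ h1 hj hij
    · exact hinj _ _ h1 hi hij.symm
  · have hi := Nat.mod_lt i hkpos
    have hj := Nat.mod_lt j hkpos
    have key : ∀ a b, b % k = a % k + 1 → b ≡ a + 1 [MOD k] := fun a b hab => by
      rw [Nat.ModEq, ← Nat.mod_add_mod a, ← hab, Nat.mod_mod]
    have key' : ∀ a b, a % k = 0 → b % k + 1 = k → a ≡ b + 1 [MOD k] := fun a b ha hb => by
      rw [Nat.ModEq, ← Nat.mod_add_mod b, hb, Nat.mod_self, ha]
    rcases le_total (i % k) (j % k) with h1 | h1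
    · rcases hchord _ _ h1 hj hij with h2 | ⟨h2, h3⟩
      · exact Or.inl (key _ _ h2)
      · exact Or.inr (key' _ _ h2 h3)
    · rcases hchord _ _ h1 hi (hR _ _ hij) with h2 | ⟨h2, h3⟩
      · exact Or.inr (key _ _ h2)
      · exact Or.inl (key' _ _ h2 h3)

theorem IsInducedOddWalk.isInducedOddCycle {H : SimpleGraph U} {k : ℕ} {c : ℕ → U}
    (h : IsInducedOddWalk R k c) (hRH : ∀ i j, R (c i) (c j) ↔ H.Adj (c i) (c j)) :
    IsInducedOddCycle H (Set.range c) := by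
  have hodd := h.odd
  have hk : 3 ≤ k := by
    by_contra hk
    obtain rfl : k = 1 := by grind
    have := (hRH _ _).1 (h.step 0)
    rw [h.periodic 0] at this
    exact H.loopless.irrefl _ this
  refine ⟨k, hodd, hk, ?_⟩
  obtain ⟨n, rfl⟩ : ∃ n, k = n + 2 := ⟨k - 2, by omega⟩
  have hper : ∀ i m, c (i + m * (n + 2)) = c i := fun i m => by
    induction m with
    | zero => simp
    | succ m ih => rw [Nat.succ_mul, ← add_assoc, h.periodic, ih]
  have hmod : ∀ i, c (i % (n + 2)) = c i := fun i => by
    conv_rhs => rw [← Nat.mod_add_div' i (n + 2)]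
    rw [hper]
  have hcong : ∀ i j, i ≡ j [MOD n + 2] → c i = c j := fun i j hij => by
    rw [← hmod i, ← hmod j, hij]
  let e : Fin (n + 2) ≃ Set.range c := Equiv.ofBijective (fun i => ⟨c i, i, rfl⟩)
    ⟨fun i j hij => Fin.ext (Nat.ModEq.eq_of_lt_of_lt
      (h.inj _ _ (congrArg Subtype.val hij)) i.2 j.2), by
      rintro ⟨_, i, rfl⟩
      exact ⟨⟨i % (n + 2), Nat.mod_lt _ (by omega)⟩, Subtype.ext (hmod i)⟩⟩
  have hfin : ∀ a b : Fin (n + 2), a - b = 1 ↔ (a : ℕ) ≡ b + 1 [MOD n + 2] := fun a b => by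
    rw [sub_eq_iff_eq_add', Fin.ext_iff, Fin.val_add, Fin.val_one, Nat.ModEq,
      Nat.mod_eq_of_lt a.2]
  refine ⟨⟨e, fun {a b} => ?_⟩⟩
  change H.Adj (c a) (c b) ↔ _
  rw [SimpleGraph.cycleGraph_adj, hfin, hfin]
  constructor
  · intro hab
    exact (h.chordless _ _ ((hRH _ _).2 hab)).symm
  · rintro (hab | hab)
    · rw [hcong _ _ hab]
      exact ((hRH _ _).1 (h.step b)).symm
    · rw [hcong _ _ hab]
      exact (hRH _ _).1 (h.step a)

/-- The vertices of an odd closed walk contain an induced odd cycle. -/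
theorem exists_isInducedOddCycle_subset_range {H : SimpleGraph U} {d : ℕ → U} {k : ℕ} (hk : Odd k)
    (h0 : d k = d 0) (hd : ∀ i < k, H.Adj (d i) (d (i + 1))) :
    ∃ s ⊆ Set.range d, IsInducedOddCycle H s := by
  let R' : U → U → Prop := fun v w => v ∈ Set.range d ∧ w ∈ Set.range d ∧ H.Adj v w
  obtain ⟨l, c, hc, -⟩ := exists_isInducedOddWalk (R := R') (u := d 0)
    (fun v w h => ⟨h.2.1, h.1, h.2.2.symm⟩) hk ⟨d, rfl, h0, fun i hi => ⟨⟨i, rfl⟩, ⟨_, rfl⟩, hd i hi⟩⟩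
  refine ⟨Set.range c, ?_, hc.isInducedOddCycle fun i j =>
    ⟨fun h => h.2.2, fun h => ⟨(hc.step i).1, (hc.step j).1, h⟩⟩⟩
  rintro _ ⟨i, rfl⟩
  exact (hc.step i).1

theorem IsInducedOddWalk.shift {k : ℕ} {c : ℕ → U} (h : IsInducedOddWalk R k c) (m : ℕ) :
    IsInducedOddWalk R k fun i => c (m + i) where
  odd := h.odd
  step i := h.step (m + i)
  periodic i := by rw [← add_assoc]; exact h.periodic (m + i)
  inj i j hij := Nat.ModEq.add_left_cancel' m (h.inj _ _ hij)
  chordless i j hij := (h.chordless _ _ hij).imp (fun h' => Nat.ModEq.add_left_cancel' m h')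
    fun h' => Nat.ModEq.add_left_cancel' m h'

end Walks

/-! ### Weights on monoid algebras and integral elements -/

section Weights

variable {K M : Type*} [Field K] [AddCommMonoid M]

/-- The part of `f` supported on the exponents of weight `w`. -/
noncomputable def weightPart (D : M →+ ℝ) (w : ℝ) (f : AddMonoidAlgebra K M) :
    AddMonoidAlgebra K M :=
  .ofCoeff (f.coeff.filter fun m => D m = w)

/-- All exponents of `f` have weight at most `w`. -/
def WeightLE (D : M →+ ℝ) (w : ℝ) (f : AddMonoidAlgebra K M) : Prop :=
  ∀ m, f.coeff m ≠ 0 → D m ≤ w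

theorem exists_of_coeff_mul_ne_zero {f g : AddMonoidAlgebra K M} {m : M}
    (h : (f * g).coeff m ≠ 0) : ∃ a b, f.coeff a ≠ 0 ∧ g.coeff b ≠ 0 ∧ a + b = m := by
  classical
  have := AddMonoidAlgebra.support_coeff_mul_subset f g (Finsupp.mem_support_iff.2 h)
  obtain ⟨a, ha, b, hb, hab⟩ := Finset.mem_add.1 this
  exact ⟨a, b, Finsupp.mem_support_iff.1 ha, Finsupp.mem_support_iff.1 hb, hab⟩

variable {D : M →+ ℝ}

theorem coeff_weightPart (w : ℝ) (f : AddMonoidAlgebra K M) (m : M) [Decidable (D m = w)] :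
    (weightPart D w f).coeff m = if D m = w then f.coeff m else 0 := by
  classical
  rw [weightPart, AddMonoidAlgebra.coeff_ofCoeff, Finsupp.filter_apply]
  congr

theorem coeff_weightPart_ne_zero {w : ℝ} {f : AddMonoidAlgebra K M} {m : M} :
    (weightPart D w f).coeff m ≠ 0 ↔ D m = w ∧ f.coeff m ≠ 0 := by
  classical
  rw [coeff_weightPart]
  simp

theorem weightPart_add (w : ℝ) (f g : AddMonoidAlgebra K M) :
    weightPart D w (f + g) = weightPart D w f + weightPart D w g := by
  classical
  ext m
  simp only [coeff_weightPart, AddMonoidAlgebra.coeff_add, Finsupp.add_apply]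
  split_ifs <;> simp

theorem weightPart_sum {ι : Type*} (w : ℝ) (s : Finset ι) (f : ι → AddMonoidAlgebra K M) :
    weightPart D w (∑ i ∈ s, f i) = ∑ i ∈ s, weightPart D w (f i) := by
  classical
  induction s using Finset.induction_on with
  | empty => ext m; simp [coeff_weightPart]
  | insert i s hi ih => rw [Finset.sum_insert hi, Finset.sum_insert hi, weightPart_add, ih]

theorem weightPart_eq_zero {w : ℝ} {f : AddMonoidAlgebra K M}
    (h : ∀ m, f.coeff m ≠ 0 → D m ≠ w) : weightPart D w f = 0 := by
  ext m
  by_contra hm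
  obtain ⟨h1, h2⟩ := coeff_weightPart_ne_zero.1 hm
  exact h m h2 h1

theorem weightPart_eq_self {w : ℝ} {f : AddMonoidAlgebra K M}
    (h : ∀ m, f.coeff m ≠ 0 → D m = w) : weightPart D w f = f := by
  classical
  ext m
  rw [coeff_weightPart]
  by_cases hm : f.coeff m = 0
  · simp [hm]
  · rw [if_pos (h m hm)]

theorem WeightLE.mul {w w' : ℝ} {f g : AddMonoidAlgebra K M} (hf : WeightLE D w f)
    (hg : WeightLE D w' g) : WeightLE D (w + w') (f * g) := by
  intro m hm
  obtain ⟨a, b, ha, hb, rfl⟩ := exists_of_coeff_mul_ne_zero hm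
  rw [map_add]
  exact add_le_add (hf a ha) (hg b hb)

/-- Top weight parts multiply. -/
theorem weightPart_mul {w w' : ℝ} {f g : AddMonoidAlgebra K M} (hf : WeightLE D w f)
    (hg : WeightLE D w' g) :
    weightPart D (w + w') (f * g) = weightPart D w f * weightPart D w' g := by
  have low : ∀ {w : ℝ} {f : AddMonoidAlgebra K M}, WeightLE D w f →
      ∀ m, (f - weightPart D w f).coeff m ≠ 0 → D m < w := by
    classical
    intro w f hf m hm
    rw [AddMonoidAlgebra.coeff_sub, Finsupp.sub_apply, coeff_weightPart] at hm
    split_ifs at hm with h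
    · simp at hm
    · exact lt_of_le_of_ne (hf m (by simpa using hm)) h
  have e : f * g = weightPart D w f * weightPart D w' g +
      (weightPart D w f * (g - weightPart D w' g) + (f - weightPart D w f) * g) := by ring
  have e1 : weightPart D (w + w') (weightPart D w f * (g - weightPart D w' g)) = 0 := by
    refine weightPart_eq_zero fun m hm => ?_
    obtain ⟨a, b, ha, hb, rfl⟩ := exists_of_coeff_mul_ne_zero hm
    rw [map_add]
    exact (add_lt_add_of_le_of_lt (coeff_weightPart_ne_zero.1 ha).1.le (low hg b hb)).ne
  have e2 : weightPart D (w + w') ((f - weightPart D w f) * g) = 0 := by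
    refine weightPart_eq_zero fun m hm => ?_
    obtain ⟨a, b, ha, hb, rfl⟩ := exists_of_coeff_mul_ne_zero hm
    rw [map_add]
    exact (add_lt_add_of_lt_of_le (low hf a ha) (hg b hb)).ne
  have e3 : weightPart D (w + w') (weightPart D w f * weightPart D w' g) =
      weightPart D w f * weightPart D w' g := by
    refine weightPart_eq_self fun m hm => ?_
    obtain ⟨a, b, ha, hb, rfl⟩ := exists_of_coeff_mul_ne_zero hm
    rw [map_add, (coeff_weightPart_ne_zero.1 ha).1, (coeff_weightPart_ne_zero.1 hb).1]
  rw [e, weightPart_add, weightPart_add, e1, e2, e3, add_zero, add_zero]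

theorem coeff_one_ne_zero {m : M} (h : (1 : AddMonoidAlgebra K M).coeff m ≠ 0) : m = 0 := by
  classical
  rw [AddMonoidAlgebra.one_def, AddMonoidAlgebra.coeff_single] at h
  by_contra hne
  exact h (Finsupp.single_eq_of_ne hne)

theorem WeightLE.pow {w : ℝ} {f : AddMonoidAlgebra K M} (hf : WeightLE D w f) (n : ℕ) :
    WeightLE D (n * w) (f ^ n) := by
  induction n with
  | zero =>
    intro m hm
    rw [pow_zero] at hm
    simp [coeff_one_ne_zero hm]
  | succ n ih =>
    have := ih.mul hf
    rw [pow_succ]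
    convert this using 1
    push_cast
    ring

theorem weightPart_pow {w : ℝ} {f : AddMonoidAlgebra K M} (hf : WeightLE D w f) (n : ℕ) :
    weightPart D (n * w) (f ^ n) = weightPart D w f ^ n := by
  induction n with
  | zero =>
    rw [pow_zero, pow_zero]
    exact weightPart_eq_self fun m hm => by simp [coeff_one_ne_zero hm]
  | succ n ih =>
    rw [pow_succ, pow_succ, ← ih, ← weightPart_mul (hf.pow n) hf]
    congr 1
    push_cast
    ring

/-- A nonpositive weight on a subalgebra stays nonpositive on integral elements: otherwise the
top weight part of `f ^ n` could not cancel in an equation of integral dependence. -/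
theorem WeightLE.of_isIntegral [UniqueSums M] {R : Subalgebra K (AddMonoidAlgebra K M)}
    (hR : ∀ r ∈ R, WeightLE D 0 r) {f : AddMonoidAlgebra K M} (hf : IsIntegral R f) :
    WeightLE D 0 f := by
  by_contra hcon
  obtain ⟨m₀, hm₀, hpos⟩ : ∃ m, f.coeff m ≠ 0 ∧ 0 < D m := by
    simpa [WeightLE] using hcon
  obtain ⟨m₁, hm₁, hmax⟩ := Finset.exists_max_image f.coeff.support D
    ⟨m₀, Finsupp.mem_support_iff.2 hm₀⟩
  set w := D m₁ with hw
  have hwpos : 0 < w := hpos.trans_le (hmax m₀ (Finsupp.mem_support_iff.2 hm₀))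
  have hfw : WeightLE D w f := fun m hm => hmax m (Finsupp.mem_support_iff.2 hm)
  have htop : weightPart D w f ≠ 0 := by
    intro h0
    have := coeff_weightPart_ne_zero (D := D).2 ⟨hw.symm, Finsupp.mem_support_iff.1 hm₁⟩
    rw [h0] at this
    simp at this
  obtain ⟨p, hp, he⟩ := hf
  rw [Polynomial.eval₂_eq_sum_range, Finset.sum_range_succ, hp.coeff_natDegree, map_one,
    one_mul] at he
  have he' := congrArg (weightPart D (p.natDegree * w)) he
  rw [weightPart_add, weightPart_sum, weightPart_pow hfw, Finset.sum_eq_zero, zero_add,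
    weightPart_eq_zero (f := 0) (by simp)] at he'
  · exact pow_ne_zero _ htop he'
  · intro i hi
    refine weightPart_eq_zero fun m hm => ?_
    have h1 := ((hR _ (p.coeff i).2).mul (hfw.pow i)) m hm
    have h2 : (i : ℝ) < p.natDegree := by exact_mod_cast Finset.mem_range.1 hi
    nlinarith

end Weights

/-! ### Toric rings -/

section ToricRing

variable {V K : Type*} [Field K] {P : Set (V → ℝ)}

/-- The monoid of the exponents `(a, k)` of the monomials of the toric ring of `P`. -/
def toricMonoid (P : Set (V → ℝ)) : AddSubmonoid ((V → ℤ) × ℕ) :=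
  AddSubmonoid.closure ((fun a : V → ℤ => (a, 1)) '' latticePoints P)

theorem mem_toricMonoid {a : V → ℤ} (ha : a ∈ latticePoints P) : (a, 1) ∈ toricMonoid P :=
  AddSubmonoid.subset_closure ⟨a, ha, rfl⟩

theorem single_mem_toricRing {m : (V → ℤ) × ℕ} (hm : m ∈ toricMonoid P) (r : K) :
    AddMonoidAlgebra.single m r ∈ toricRing K P := by
  have h1 : AddMonoidAlgebra.single m (1 : K) ∈ toricRing K P := by
    induction hm using AddSubmonoid.closure_induction with
    | mem x hx =>
      obtain ⟨a, ha, rfl⟩ := hx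
      exact Algebra.subset_adjoin ⟨a, ha, rfl⟩
    | zero => exact one_mem _
    | add x y _ _ hx hy => simpa [AddMonoidAlgebra.single_mul_single] using mul_mem hx hy
  have := (toricRing K P).smul_mem h1 r
  rwa [AddMonoidAlgebra.smul_single', mul_one] at this

theorem mem_toricRing {f : AddMonoidAlgebra K ((V → ℤ) × ℕ)} :
    f ∈ toricRing K P ↔ ∀ m, f.coeff m ≠ 0 → m ∈ toricMonoid P := by
  classical
  constructor
  · intro hf
    induction hf using Algebra.adjoin_induction with
    | mem x hx =>
      obtain ⟨a, ha, rfl⟩ := hx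
      intro m hm
      rw [AddMonoidAlgebra.coeff_single] at hm
      obtain rfl : m = (a, 1) := by
        by_contra hne
        exact hm (Finsupp.single_eq_of_ne hne)
      exact mem_toricMonoid ha
    | algebraMap r =>
      intro m hm
      rw [AddMonoidAlgebra.coe_algebraMap] at hm
      obtain rfl : m = 0 := by
        by_contra hne
        exact hm (Finsupp.single_eq_of_ne hne)
      exact zero_mem _
    | add x y _ _ hx hy =>
      intro m hm
      by_cases h : x.coeff m = 0
      · refine hy m fun h' => hm ?_
        simp [h, h']
      · exact hx m h
    | mul x y _ _ hx hy =>
      intro m hm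
      obtain ⟨a, b, ha, hb, rfl⟩ := exists_of_coeff_mul_ne_zero hm
      exact add_mem (hx a ha) (hy b hb)
  · intro h
    rw [← AddMonoidAlgebra.sum_coeff_single f]
    exact sum_mem fun m hm => single_mem_toricRing (h m (Finsupp.mem_support_iff.1 hm)) _

theorem nonpos_of_mem_toricMonoid {D : (V → ℤ) × ℕ →+ ℝ}
    (hD : ∀ a ∈ latticePoints P, D (a, 1) ≤ 0) {m : (V → ℤ) × ℕ} (hm : m ∈ toricMonoid P) :
    D m ≤ 0 := by
  induction hm using AddSubmonoid.closure_induction with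
  | mem x hx =>
    obtain ⟨a, ha, rfl⟩ := hx
    exact hD a ha
  | zero => simp
  | add x y _ _ hx hy =>
    rw [map_add]
    exact add_nonpos hx hy

/-- Integral closedness passes to a subalgebra that contains every element of the larger ring
integral over it. -/
theorem isIntegrallyClosed_of_le {A : Type*} [CommRing A] [IsDomain A] [Algebra K A]
    {R B : Subalgebra K A} (hRB : R ≤ B) [IsIntegrallyClosed B]
    (h : ∀ f ∈ B, IsIntegral R f → f ∈ R) : IsIntegrallyClosed R := by
  let _ : Algebra R B := (Subalgebra.inclusion hRB).toRingHom.toAlgebra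
  have : IsScalarTower R B A := IsScalarTower.of_algebraMap_eq fun _ => rfl
  have hinj : Function.Injective (algebraMap R B) := Subalgebra.inclusion_injective hRB
  have : FaithfulSMul R B := (faithfulSMul_iff_algebraMap_injective R B).2 hinj
  have : IsIntegrallyClosedIn R B := by
    rw [isIntegrallyClosedIn_iff]
    refine ⟨hinj, fun {x} hx => ?_⟩
    exact ⟨⟨x, h x x.2 (hx.map (IsScalarTower.toAlgHom R B A))⟩, Subtype.ext rfl⟩
  exact IsIntegrallyClosed.of_isIntegrallyClosed_of_isIntegrallyClosedIn R B

/-- The exponents of a polynomial ring, among those of Laurent monomials. -/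
def polynomialExponent (V : Type*) : (Option V →₀ ℕ) →+ (V → ℤ) × ℕ where
  toFun c := (fun v => (c (some v) : ℤ), c none)
  map_zero' := rfl
  map_add' c d := by ext <;> simp

theorem polynomialExponent_injective : Function.Injective (polynomialExponent V) := by
  intro c d h
  ext u
  cases u with
  | none => exact congrArg Prod.snd h
  | some v =>
    have := congrFun (congrArg Prod.fst h) v
    simpa [polynomialExponent] using this

/-- The polynomial subring of the Laurent polynomial ring. -/
noncomputable def polynomialSubring (V K : Type*) [Field K] :
    Subalgebra K (AddMonoidAlgebra K ((V → ℤ) × ℕ)) :=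
  (AddMonoidAlgebra.mapDomainAlgHom K K (polynomialExponent V)).range

instance : IsIntegrallyClosed (polynomialSubring V K) := by
  have hinj : Function.Injective
      (AddMonoidAlgebra.mapDomainAlgHom K K (polynomialExponent V)) :=
    AddMonoidAlgebra.mapDomain_injective polynomialExponent_injective
  have : IsIntegrallyClosed (MvPolynomial (Option V) K) := inferInstance
  exact IsIntegrallyClosed.of_equiv (R := MvPolynomial (Option V) K)
    (AlgEquiv.ofInjective _ hinj).toRingEquiv

theorem toricRing_le_polynomialSubring [Finite V] (hP : ∀ a ∈ latticePoints P, 0 ≤ a) :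
    toricRing K P ≤ polynomialSubring V K := by
  refine Algebra.adjoin_le ?_
  rintro _ ⟨a, ha, rfl⟩
  refine ⟨AddMonoidAlgebra.single
    (Finsupp.equivFunOnFinite.symm fun u : Option V => u.elim 1 fun v => (a v).toNat) 1, ?_⟩
  change AddMonoidAlgebra.mapDomain _ _ = _
  rw [AddMonoidAlgebra.mapDomain_single]
  congr 1
  ext v
  · simpa [polynomialExponent] using hP a ha v
  · simp [polynomialExponent]

end ToricRing

/-! ### Homogenized points -/

section Homogenization

variable {V : Type*}

/-- The point `(a, 1)` of the cone over a lattice polytope. -/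
def homPoint (a : V → ℤ) : (V → ℝ) × ℝ := (toReal a, 1)

theorem linearIndepOn_homPoint_iff {S : Finset (V → ℤ)} :
    LinearIndepOn ℝ homPoint (S : Set (V → ℤ)) ↔
      AffineIndependent ℝ (fun a : S => toReal (a : V → ℤ)) := by
  have key : ∀ (s : Finset S) (w : S → ℝ), ∑ e ∈ s, w e • homPoint (e : V → ℤ) = 0 ↔
      s.sum w = 0 ∧ ∑ e ∈ s, w e • toReal (e : V → ℤ) = 0 := by
    intro s w
    rw [Prod.ext_iff, Prod.fst_sum, Prod.snd_sum, and_comm]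
    simp [homPoint]
  rw [affineIndependent_iff, LinearIndepOn, linearIndependent_iff']
  constructor
  · intro h s w h1 h2
    exact h s w ((key s w).2 ⟨h1, h2⟩)
  · intro h s w h1
    exact h s w ((key s w).1 h1).1 ((key s w).1 h1).2

theorem mem_convexHull_toReal_iff {S : Finset (V → ℤ)} {x : V → ℝ} :
    x ∈ convexHull ℝ (toReal '' (S : Set (V → ℤ))) ↔
      ∃ l : (V → ℤ) → ℝ, (∀ t ∈ S, 0 ≤ l t) ∧ ∑ t ∈ S, l t • homPoint t = (x, 1) := by
  classical
  have key : ∀ (l : (V → ℤ) → ℝ) (y : V → ℝ) (r : ℝ), ∑ t ∈ S, l t • homPoint t = (y, r) ↔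
      ∑ t ∈ S, l t • toReal t = y ∧ ∑ t ∈ S, l t = r := by
    intro l y r
    rw [Prod.ext_iff, Prod.fst_sum, Prod.snd_sum]
    simp [homPoint]
  constructor
  · intro hx
    refine convexHull_min
      (t := {x | ∃ l : (V → ℤ) → ℝ, (∀ t ∈ S, 0 ≤ l t) ∧ ∑ t ∈ S, l t • homPoint t = (x, 1)})
      ?_ ?_ hx
    · rintro _ ⟨t, ht, rfl⟩
      refine ⟨fun s => if s = t then 1 else 0, fun s _ => by positivity, ?_⟩
      simp [homPoint, Finset.mem_coe.1 ht]
    · rintro x ⟨l, hl, hlx⟩ y ⟨m, hm, hmy⟩ a b ha hb hab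
      refine ⟨fun t => a * l t + b * m t, fun t ht =>
        add_nonneg (mul_nonneg ha (hl t ht)) (mul_nonneg hb (hm t ht)), ?_⟩
      simp only [add_smul, mul_smul, Finset.sum_add_distrib, ← Finset.smul_sum, hlx, hmy]
      ext <;> simp [hab]
  · rintro ⟨l, hl, hlx⟩
    obtain ⟨h1, h2⟩ := (key l x 1).1 hlx
    rw [← h1]
    exact (convex_convexHull ℝ _).sum_mem hl h2 fun t ht =>
      subset_convexHull ℝ _ ⟨t, ht, rfl⟩

theorem exists_sum_of_mem_homLattice {S : Finset (V → ℤ)} {y : (V → ℤ) × ℤ}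
    (hy : y ∈ homLattice (S : Set (V → ℤ))) :
    ∃ n : (V → ℤ) → ℤ, ∑ t ∈ S, n t • (t, (1 : ℤ)) = y := by
  classical
  induction hy using AddSubgroup.closure_induction with
  | mem x hx =>
    obtain ⟨t, ht, rfl⟩ := hx
    refine ⟨fun s => if s = t then 1 else 0, ?_⟩
    simp [ite_smul, Finset.mem_coe.1 ht]
  | zero => exact ⟨0, by simp⟩
  | add x y _ _ hx hy =>
    obtain ⟨n, rfl⟩ := hx
    obtain ⟨m, rfl⟩ := hy
    exact ⟨n + m, by simp only [Pi.add_apply, add_smul, Finset.sum_add_distrib]⟩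
  | neg x _ hx =>
    obtain ⟨n, rfl⟩ := hx
    exact ⟨-n, by simp only [Pi.neg_apply, neg_smul, Finset.sum_neg_distrib]⟩

/-- The real point of an integral vector of `ℤ^V × ℤ`. -/
def prodToReal : (V → ℤ) × ℤ →+ (V → ℝ) × ℝ :=
  AddMonoidHom.mk' (fun y => (toReal y.1, (y.2 : ℝ))) fun x y => by
    ext <;> simp [toReal]

theorem prodToReal_apply (a : V → ℤ) (k : ℤ) : prodToReal (a, k) = (toReal a, (k : ℝ)) := rfl

theorem prodToReal_smul_one (n : ℤ) (t : V → ℤ) :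
    prodToReal (n • (t, (1 : ℤ))) = (n : ℝ) • homPoint t := by
  rw [map_zsmul, prodToReal_apply, Int.cast_one, ← homPoint, Int.cast_smul_eq_zsmul]

end Homogenization

/-! ### Unimodular coverings and normality -/

section Covering

variable {V : Type*} {P : Set (V → ℝ)}

/-- The toric ring of `P` is integrally closed if its monoid contains every Laurent exponent on
which all weights that are nonpositive on `P` are nonpositive. -/
theorem isNormal_of_saturated [Finite V] (K : Type*) [Field K]
    (hP : ∀ a ∈ latticePoints P, 0 ≤ a)
    (h : ∀ m, (∀ D : (V → ℤ) × ℕ →+ ℝ, (∀ b ∈ latticePoints P, D (b, 1) ≤ 0) → D m ≤ 0) →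
      m ∈ toricMonoid P) : IsNormal K P := by
  refine isIntegrallyClosed_of_le (toricRing_le_polynomialSubring hP) fun f _ hf => ?_
  refine mem_toricRing.2 fun m hm => h m fun D hD => ?_
  refine WeightLE.of_isIntegral (fun r hr => ?_) hf m hm
  exact fun m hm => nonpos_of_mem_toricMonoid hD (mem_toricRing.1 hr m hm)

/-- The coordinates of a lattice point of the cone over a unimodular simplex are nonnegative
integers. -/
theorem mem_toricMonoid_of_mem_simplex {S : Finset (V → ℤ)} (hS : IsUnimodularSimplex P S)
    (hP : homLattice (latticePoints P) = ⊤) {a : V → ℤ} {k : ℕ} (hk : 0 < k)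
    (ha : (k : ℝ)⁻¹ • toReal a ∈ convexHull ℝ (toReal '' (S : Set (V → ℤ)))) :
    (a, k) ∈ toricMonoid P := by
  have hk' : (k : ℝ) ≠ 0 := by exact_mod_cast hk.ne'
  obtain ⟨l, hl, hlx⟩ := mem_convexHull_toReal_iff.1 ha
  obtain ⟨n, hn⟩ := exists_sum_of_mem_homLattice (S := S) (y := (a, (k : ℤ)))
    (by rw [hS.lattice_eq, hP]; trivial)
  have hn' := congrArg prodToReal hn
  rw [map_sum, prodToReal_apply] at hn'
  simp only [prodToReal_smul_one] at hn'
  have hdiff : ∑ t ∈ S, ((n t : ℝ) - k * l t) • homPoint t = 0 := by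
    simp only [sub_smul, mul_smul, Finset.sum_sub_distrib, ← Finset.smul_sum, hlx, hn']
    ext <;> simp [hk']
  have hz := linearIndepOn_finset_iff.1 (linearIndepOn_homPoint_iff.2 hS.affineIndependent) _ hdiff
  have hnn : ∀ t ∈ S, 0 ≤ n t := fun t ht => by
    have h1 : (n t : ℝ) = k * l t := sub_eq_zero.1 (hz t ht)
    have h2 : (0 : ℝ) ≤ n t := by
      rw [h1]
      exact mul_nonneg (Nat.cast_nonneg k) (hl t ht)
    exact_mod_cast h2
  have hsum : ∑ t ∈ S, (n t).toNat • (t, 1) = (a, k) := by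
    rw [Prod.ext_iff, Prod.fst_sum, Prod.snd_sum] at hn ⊢
    refine ⟨hn.1 ▸ Finset.sum_congr rfl fun t ht => ?_, ?_⟩
    · simp only [Prod.smul_fst]
      conv_rhs => rw [← Int.toNat_of_nonneg (hnn t ht)]
      rw [natCast_zsmul]
    · zify
      refine Eq.trans (Finset.sum_congr rfl fun t ht => ?_) hn.2
      simp [hnn t ht]
  rw [← hsum]
  exact sum_mem fun t ht => nsmul_mem (mem_toricMonoid (hS.subset ht)) _

theorem HasUnimodularCovering.isNormal [Finite V] (K : Type*) [Field K]
    (hcov : HasUnimodularCovering P) (hconv : Convex ℝ P)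
    (hP : ∀ a ∈ latticePoints P, 0 ≤ a ∧ a ≤ 1) (hlat : homLattice (latticePoints P) = ⊤) :
    IsNormal K P := by
  obtain ⟨C, hC, hPC⟩ := hcov
  have hclosed : IsClosed P := by
    rw [hPC]
    refine Set.Finite.isClosed_biUnion C.finite_toSet fun S _ => ?_
    exact ((S.finite_toSet.image toReal).isCompact_convexHull ℝ).isClosed
  refine isNormal_of_saturated K (fun a ha => (hP a ha).1) fun ⟨a, k⟩ hD => ?_
  rcases Nat.eq_zero_or_pos k with rfl | hk
  -- In degree `0`, the weights bounding each coordinate from both sides force `a = 0`.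
  · obtain rfl : a = 0 := by
      ext v
      have h1 := hD (AddMonoidHom.mk' (fun m => (m.1 v : ℝ) - m.2) fun x y => by
        simp only [Prod.fst_add, Prod.snd_add, Pi.add_apply]; push_cast; ring) fun b hb => by
          have : b v ≤ 1 := (hP b hb).2 v
          have : (b v : ℝ) ≤ 1 := by exact_mod_cast this
          simpa using this
      have h2 := hD (AddMonoidHom.mk' (fun m => -(m.1 v : ℝ)) fun x y => by
        simp only [Prod.fst_add, Pi.add_apply]; push_cast; ring) fun b hb => by
          have : 0 ≤ b v := (hP b hb).1 v
          have : (0 : ℝ) ≤ b v := by exact_mod_cast this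
          simpa using this
      simp only [AddMonoidHom.mk'_apply, Nat.cast_zero, sub_zero, Left.neg_nonpos_iff] at h1 h2
      have h3 : (a v : ℝ) = 0 := le_antisymm h1 h2
      exact_mod_cast h3
    exact zero_mem _
  · have hk' : (0 : ℝ) < k := by exact_mod_cast hk
    have hmem : (k : ℝ)⁻¹ • toReal a ∈ P := by
      by_contra hnot
      obtain ⟨l, u, h1, h2⟩ := geometric_hahn_banach_closed_point hconv hclosed hnot
      have h3 := hD (AddMonoidHom.mk' (fun m => l (toReal m.1) - u * m.2) fun x y => by
        have : toReal (x + y).1 = toReal x.1 + toReal y.1 := by ext; simp [toReal]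
        rw [this, map_add, Prod.snd_add]; push_cast; ring) fun b hb => by
          have := h1 _ hb
          simp only [AddMonoidHom.mk'_apply, Nat.cast_one]
          linarith
      simp only [AddMonoidHom.mk'_apply] at h3
      rw [map_smul, smul_eq_mul, inv_mul_eq_div, lt_div_iff₀ hk'] at h2
      linarith
    rw [hPC] at hmem
    obtain ⟨S, hS, hmem⟩ := Set.mem_iUnion₂.1 hmem
    exact mem_toricMonoid_of_mem_simplex (hC S hS) hlat hk hmem

end Covering

/-! ### Lattice points of the two polytopes -/

section LatticePoints

variable {V : Type*}

open Classical in
/-- The vector `e_v` for `u = some v`, and `0` for the apex `u = none`. -/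
noncomputable def eps (u : Option V) : V → ℤ := fun w => if u = some w then 1 else 0

@[simp] theorem eps_none : eps (none : Option V) = 0 := by
  ext
  simp [eps]

theorem eps_some_self (v : V) : eps (some v) v = 1 := by simp [eps]

theorem eps_some_of_ne {v w : V} (h : v ≠ w) : eps (some v) w = 0 := by simp [eps, h]

theorem sum_eps_some [DecidableEq V] (s : Finset V) (v : V) :
    ∑ w ∈ s, eps (some v) w = if v ∈ s then 1 else 0 := by
  simp [eps]

theorem eps_nonneg (u : Option V) : 0 ≤ eps u := fun v => by
  rw [eps]
  split_ifs <;> simp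

/-- Adjacency in the cone over `H` with apex `none`, the apex carrying a loop. Under
`{u, w} ↦ eps u + eps w` its edges are the lattice points of the stable set polytope. -/
def ConeAdj (H : SimpleGraph V) : Option V → Option V → Prop
  | some v, some w => H.Adj v w
  | _, _ => True

theorem ConeAdj.symm {H : SimpleGraph V} : ∀ {u w : Option V}, ConeAdj H u w → ConeAdj H w u
  | some _, some _, h => SimpleGraph.Adj.symm (G := H) h
  | none, none, _ => trivial
  | none, some _, _ => trivial
  | some _, none, _ => trivial

theorem toReal_injective : Function.Injective (toReal : (V → ℤ) → V → ℝ) := fun a b h => by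
  ext v
  exact Int.cast_injective (α := ℝ) (congrFun h v)

theorem toReal_add (a b : V → ℤ) : toReal (a + b) = toReal a + toReal b := by
  ext
  simp [toReal]

theorem toReal_eps_some (v : V) : toReal (eps (some v)) = rho {v} := by
  classical
  ext w
  by_cases h : v = w
  · subst h
    simp [toReal, rho, eps_some_self]
  · simp [toReal, rho, eps_some_of_ne h, Ne.symm h]

theorem toReal_eps_add_eps {v w : V} (h : v ≠ w) :
    toReal (eps (some v) + eps (some w)) = rho {v, w} := by
  classical
  rw [toReal_add, toReal_eps_some, toReal_eps_some]
  exact (Set.indicator_union_of_disjoint (Set.disjoint_singleton.2 h) fun _ => (1 : ℝ)).symm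

/-- An integer point of the convex hull of a set of `0/1`-vectors belongs to that set, being a
vertex of the cube. -/
theorem toReal_mem_of_mem_convexHull {Z : Set (V → ℝ)} (hZ : ∀ x ∈ Z, ∀ v, x v = 0 ∨ x v = 1)
    {a : V → ℤ} (ha : toReal a ∈ convexHull ℝ Z) : toReal a ∈ Z := by
  set cube : Set (V → ℝ) := Set.univ.pi fun _ => Set.Icc (0 : ℝ) 1
  have hcube : convexHull ℝ Z ⊆ cube := by
    refine convexHull_min (fun x hx v _ => ?_) (convex_pi fun _ _ => convex_Icc 0 1)
    rcases hZ x hx v with h | h <;> simp [h]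
  have hext : toReal a ∈ cube.extremePoints ℝ := by
    rw [extremePoints_pi]
    intro v _
    have h := hcube ha v trivial
    have h0 : (0 : ℝ) ≤ (a v : ℝ) := h.1
    have h1 : (a v : ℝ) ≤ 1 := h.2
    norm_cast at h0 h1
    have h01 : a v = 0 ∨ a v = 1 := by omega
    rw [mem_extremePoints]
    refine ⟨h, fun x hx y hy hxy => ?_⟩
    obtain ⟨s, t, hs, ht, hst, he⟩ := hxy
    simp only [smul_eq_mul, toReal] at he ⊢
    obtain ⟨hx0, hx1⟩ := hx
    obtain ⟨hy0, hy1⟩ := hy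
    rcases h01 with h01 | h01 <;> rw [h01] at he ⊢ <;> push_cast at he ⊢
    · have e1 : s * x = 0 := by nlinarith [mul_nonneg hs.le hx0, mul_nonneg ht.le hy0]
      have e2 : t * y = 0 := by linarith
      exact ⟨(mul_eq_zero.1 e1).resolve_left hs.ne', (mul_eq_zero.1 e2).resolve_left ht.ne'⟩
    · have e1 : s * (1 - x) = 0 := by
        nlinarith [mul_nonneg hs.le (sub_nonneg.2 hx1), mul_nonneg ht.le (sub_nonneg.2 hy1)]
      have e2 : t * (1 - y) = 0 := by linarith
      exact ⟨by linarith [(mul_eq_zero.1 e1).resolve_left hs.ne'],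
        by linarith [(mul_eq_zero.1 e2).resolve_left ht.ne']⟩
  exact extremePoints_convexHull_subset
    (inter_extremePoints_subset_extremePoints_of_subset hcube ⟨ha, hext⟩)

theorem rho_eq_zero_or_one (W : Set V) (v : V) : rho W v = 0 ∨ rho W v = 1 := by
  by_cases h : v ∈ W <;> simp [rho, h]

theorem rho_add_rho {v w : V} (h : v ≠ w) : (rho {v} + rho {w} : V → ℝ) = rho {v, w} := by
  rw [← toReal_eps_add_eps h, toReal_add, toReal_eps_some, toReal_eps_some]

theorem mem_latticePoints_edgePolytope {H : SimpleGraph V} {a : V → ℤ} :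
    a ∈ latticePoints (edgePolytope H) ↔
      ∃ v w, H.Adj v w ∧ a = eps (some v) + eps (some w) := by
  constructor
  · intro ha
    obtain ⟨v, w, hvw, h⟩ := toReal_mem_of_mem_convexHull (by
      rintro x ⟨v, w, hvw, rfl⟩ z
      rw [rho_add_rho hvw.ne]
      exact rho_eq_zero_or_one _ _) ha
    refine ⟨v, w, hvw, toReal_injective ?_⟩
    rw [h, toReal_add, toReal_eps_some, toReal_eps_some]
  · rintro ⟨v, w, hvw, rfl⟩
    refine subset_convexHull ℝ _ ⟨v, w, hvw, ?_⟩
    rw [toReal_add, toReal_eps_some, toReal_eps_some]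

theorem nonneg_le_one_of_mem_latticePoints {G : SimpleGraph V} {a : V → ℤ}
    (ha : a ∈ latticePoints (stableSetPolytope G)) : 0 ≤ a ∧ a ≤ 1 := by
  obtain ⟨W, -, h⟩ := toReal_mem_of_mem_convexHull (by
      rintro x ⟨W, -, rfl⟩ z
      exact rho_eq_zero_or_one _ _) ha
  have h01 : ∀ v, a v = 0 ∨ a v = 1 := fun v => by
    have h2 := rho_eq_zero_or_one W v
    rw [← h] at h2
    unfold toReal at h2
    exact_mod_cast h2
  refine ⟨fun v => ?_, fun v => ?_⟩ <;> rcases h01 v with h | h <;> simp [h]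

section StableSet

variable [Fintype V] {G : SimpleGraph V}

theorem mem_latticePoints_stableSetPolytope (hG : G.indepNum = 2) {a : V → ℤ} :
    a ∈ latticePoints (stableSetPolytope G) ↔
      ∃ u w, ConeAdj Gᶜ u w ∧ a = eps u + eps w := by
  classical
  constructor
  · intro ha
    obtain ⟨W, hW, h⟩ := toReal_mem_of_mem_convexHull (by
      rintro x ⟨W, -, rfl⟩ z
      exact rho_eq_zero_or_one _ _) ha
    have hcard : W.toFinset.card ≤ 2 := by
      rw [← hG]
      exact SimpleGraph.IsIndepSet.card_le_indepNum (by simpa using hW)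
    have hcases : W.toFinset.card = 0 ∨ W.toFinset.card = 1 ∨ W.toFinset.card = 2 := by omega
    rcases hcases with hc | hc | hc
    · refine ⟨none, none, trivial, toReal_injective ?_⟩
      rw [Finset.card_eq_zero, Set.toFinset_eq_empty] at hc
      rw [h, hc]
      ext
      simp [rho, toReal]
    · obtain ⟨v, hv⟩ := Finset.card_eq_one.1 hc
      refine ⟨none, some v, trivial, toReal_injective ?_⟩
      have hWv : W = {v} := by rw [← Set.coe_toFinset W, hv, Finset.coe_singleton]
      rw [h, hWv, eps_none, zero_add, toReal_eps_some]
    · obtain ⟨v, w, hvw, hv⟩ := Finset.card_eq_two.1 hc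
      have hWv : W = {v, w} := by rw [← Set.coe_toFinset W, hv]; simp
      subst hWv
      refine ⟨some v, some w, ?_, toReal_injective ?_⟩
      · exact (SimpleGraph.compl_adj _ _ _).2 ⟨hvw, hW (by simp) (by simp) hvw⟩
      · rw [h, toReal_eps_add_eps hvw]
  · have single : ∀ v, eps (some v) ∈ latticePoints (stableSetPolytope G) := fun v =>
      subset_convexHull ℝ _ ⟨{v}, by simp, toReal_eps_some v⟩
    rintro ⟨u, w, huw, rfl⟩
    match u, w, huw with
    | none, none, _ =>
      refine subset_convexHull ℝ _ ⟨∅, by simp, ?_⟩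
      ext
      simp [rho, toReal]
    | none, some v, _ => simpa using single v
    | some v, none, _ => simpa using single v
    | some v, some w, h =>
      obtain ⟨hne, hadj⟩ := (SimpleGraph.compl_adj _ _ _).1 h
      refine subset_convexHull ℝ _ ⟨{v, w}, ?_, toReal_eps_add_eps hne⟩
      rw [SimpleGraph.isIndepSet_iff, Set.pairwise_pair]
      exact fun _ => ⟨hadj, fun h' => hadj h'.symm⟩

theorem eps_some_mem (hG : G.indepNum = 2) (v : V) :
    eps (some v) ∈ latticePoints (stableSetPolytope G) :=
  (mem_latticePoints_stableSetPolytope hG).2 ⟨none, some v, trivial, by simp⟩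

theorem zero_mem_latticePoints (hG : G.indepNum = 2) :
    (0 : V → ℤ) ∈ latticePoints (stableSetPolytope G) :=
  (mem_latticePoints_stableSetPolytope hG).2 ⟨none, none, trivial, by simp⟩

theorem sum_smul_eps (a : V → ℤ) : ∑ v, a v • eps (some v) = a := by
  classical
  ext w
  simp [eps]

theorem homLattice_stableSetPolytope (hG : G.indepNum = 2) :
    homLattice (latticePoints (stableSetPolytope G)) = ⊤ := by
  rw [eq_top_iff]
  rintro ⟨a, k⟩ -
  have h0 : ((0 : V → ℤ), (1 : ℤ)) ∈ homLattice (latticePoints (stableSetPolytope G)) :=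
    AddSubgroup.subset_closure ⟨0, zero_mem_latticePoints hG, rfl⟩
  have h1 : ∀ v : V, (eps (some v), (0 : ℤ)) ∈
      homLattice (latticePoints (stableSetPolytope G)) := fun v => by
    have h1 : (eps (some v), (1 : ℤ)) ∈ homLattice (latticePoints (stableSetPolytope G)) :=
      AddSubgroup.subset_closure ⟨_, eps_some_mem hG v, rfl⟩
    simpa using sub_mem h1 h0
  have e : (a, k) = ∑ v, a v • (eps (some v), (0 : ℤ)) + k • ((0 : V → ℤ), (1 : ℤ)) := by
    rw [Prod.ext_iff, Prod.fst_add, Prod.snd_add, Prod.fst_sum, Prod.snd_sum]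
    refine ⟨?_, by simp⟩
    simp only [Prod.smul_fst, smul_zero, add_zero]
    exact (sum_smul_eps a).symm
  rw [e]
  exact add_mem (sum_mem fun v _ => zsmul_mem (h1 v) _) (zsmul_mem h0 _)

end StableSet

end LatticePoints

/-! ### Odd holes and the toric ring -/

section OddHoles

variable {V : Type*} [Fintype V] {G : SimpleGraph V}

/-- The complement of a graph with stability number two has no triangles. -/
theorem isOddHole_compl_iff (hG : G.indepNum = 2) {s : Set V} :
    IsOddHole Gᶜ s ↔ IsInducedOddCycle Gᶜ s := by
  classical
  constructor
  · rintro ⟨k, h1, h2, h3⟩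
    exact ⟨k, h1, h2.le, h3⟩
  · rintro ⟨k, h1, h2, ⟨e⟩⟩
    refine ⟨k, h1, lt_of_le_of_ne h2 ?_, ⟨e⟩⟩
    rintro rfl
    have hadj : ∀ i j : Fin 3, i ≠ j → Gᶜ.Adj (e i) (e j) := fun i j hij => by
      have : (SimpleGraph.cycleGraph 3).Adj i j := by
        rw [SimpleGraph.cycleGraph_adj]
        revert i j
        decide
      exact (SimpleGraph.Iso.map_adj_iff e).2 this
    have hinj : Function.Injective fun i => (e i : V) :=
      Subtype.val_injective.comp e.injective
    have := SimpleGraph.IsIndepSet.card_le_indepNum (G := G)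
      (t := Finset.univ.image fun i => (e i : V)) (by
        intro x hx y hy hxy
        simp only [Finset.coe_image, Finset.coe_univ, Set.image_univ, Set.mem_range] at hx hy
        obtain ⟨i, rfl⟩ := hx
        obtain ⟨j, rfl⟩ := hy
        exact ((SimpleGraph.compl_adj _ _ _).1 (hadj i j fun h => hxy (by rw [h]))).2)
    rw [Finset.card_image_of_injective _ hinj, hG] at this
    simp at this

theorem oddCycleCondition_iff_oddHoleCondition (hG : G.indepNum = 2) :
    OddCycleCondition Gᶜ ↔ OddHoleCondition Gᶜ := by
  constructor
  · intro h s t hs ht hst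
    refine (h s t ((isOddHole_compl_iff hG).1 hs) ((isOddHole_compl_iff hG).1 ht)).resolve_left ?_
    rw [Set.not_nonempty_iff_eq_empty]
    exact hst.inter_eq
  · intro h s t hs ht
    by_cases hst : (s ∩ t).Nonempty
    · exact Or.inl hst
    · exact Or.inr (h s t ((isOddHole_compl_iff hG).2 hs) ((isOddHole_compl_iff hG).2 ht)
        (Set.disjoint_iff_inter_eq_empty.2 (Set.not_nonempty_iff_eq_empty.1 hst)))

theorem sum_univ_eps_some (v : V) : ∑ w, eps (some v) w = 1 := by
  classical
  simp [sum_eps_some]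

/-- An exponent `(a, k)` with `∑ a = 2 k` is a sum of `k` edges; if it lives on two vertex sets
without edges between them, then each of the two sets carries an even part of it. -/
theorem even_of_mem_toricMonoid (hG : G.indepNum = 2) {s t : Finset V} (hst : Disjoint s t)
    (hno : ∀ i ∈ s, ∀ j ∈ t, ¬ Gᶜ.Adj i j) {m : (V → ℤ) × ℕ}
    (hm : m ∈ toricMonoid (stableSetPolytope G)) :
    0 ≤ m.1 ∧ ∑ v, m.1 v ≤ 2 * m.2 ∧ (∑ v, m.1 v = 2 * m.2 →
      (∀ v, v ∉ s → v ∉ t → m.1 v = 0) → Even (∑ v ∈ s, m.1 v)) := by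
  classical
  induction hm using AddSubmonoid.closure_induction with
  | mem x hx =>
    obtain ⟨a, ha, rfl⟩ := hx
    obtain ⟨u, w, huw, rfl⟩ := (mem_latticePoints_stableSetPolytope hG).1 ha
    refine ⟨add_nonneg (eps_nonneg u) (eps_nonneg w), ?_⟩
    match u, w, huw with
    | none, none, _ => simp
    | none, some v, _ => simp [sum_univ_eps_some]
    | some v, none, _ => simp [sum_univ_eps_some]
    | some v, some w, h =>
      have hadj : Gᶜ.Adj v w := h
      refine ⟨by simp [Finset.sum_add_distrib, sum_univ_eps_some], fun _ hsupp => ?_⟩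
      simp only [Pi.add_apply, Finset.sum_add_distrib, sum_eps_some] at hsupp ⊢
      have hv : v ∈ s ∨ v ∈ t := by
        by_contra hcon
        push Not at hcon
        have h1 := hsupp v hcon.1 hcon.2
        have h2 : 0 ≤ eps (some w) v := eps_nonneg (some w) v
        rw [eps_some_self] at h1
        omega
      have hw : w ∈ s ∨ w ∈ t := by
        by_contra hcon
        push Not at hcon
        have h1 := hsupp w hcon.1 hcon.2
        have h2 : 0 ≤ eps (some v) w := eps_nonneg (some v) w
        rw [eps_some_self] at h1
        omega
      rcases hv with hv | hv <;> rcases hw with hw | hw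
      · simp [hv, hw]
      · exact absurd hadj (hno v hv w hw)
      · exact absurd hadj.symm (hno w hw v hv)
      · simp [Finset.disjoint_right.1 hst hv, Finset.disjoint_right.1 hst hw]
  | zero => simp
  | add x y _ _ hx hy =>
    obtain ⟨hx0, hx1, hx2⟩ := hx
    obtain ⟨hy0, hy1, hy2⟩ := hy
    refine ⟨add_nonneg hx0 hy0, ?_, fun h hsupp => ?_⟩
    · simp only [Prod.fst_add, Prod.snd_add, Pi.add_apply, Finset.sum_add_distrib]
      push_cast
      linarith
    · simp only [Prod.fst_add, Prod.snd_add, Pi.add_apply, Finset.sum_add_distrib] at h hsupp ⊢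
      push_cast at h
      refine (hx2 (by linarith) fun v h1 h2 => ?_).add (hy2 (by linarith) fun v h1 h2 => ?_)
      · have h3 : 0 ≤ x.1 v := hx0 v
        have h4 : 0 ≤ y.1 v := hy0 v
        linarith [hsupp v h1 h2]
      · have h3 : 0 ≤ x.1 v := hx0 v
        have h4 : 0 ≤ y.1 v := hy0 v
        linarith [hsupp v h1 h2]

/-- Twice the indicator vector of a cycle is the sum of its edges. -/
theorem two_smul_mem_of_isOddHole (hG : G.indepNum = 2) {s : Finset V}
    (hs : IsOddHole Gᶜ (s : Set V)) :
    Odd s.card ∧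
      (2 • ∑ v ∈ s, eps (some v), s.card) ∈ toricMonoid (stableSetPolytope G) := by
  classical
  obtain ⟨k, hodd, hk, ⟨e⟩⟩ := hs
  obtain ⟨n, rfl⟩ : ∃ n, k = n + 2 := ⟨k - 2, by omega⟩
  have hcard : s.card = n + 2 := by
    have := Fintype.card_congr e.toEquiv
    simpa using this.symm
  refine ⟨hcard ▸ hodd, ?_⟩
  have h1 : ∑ v ∈ s, eps (some v) = ∑ i, eps (some (e i : V)) := by
    rw [← Finset.sum_coe_sort s]
    exact (Equiv.sum_comp e.toEquiv fun v : (s : Set V) => eps (some (v : V))).symm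
  have h2 : ∑ i, eps (some (e (i + 1) : V)) = ∑ i, eps (some (e i : V)) :=
    Equiv.sum_comp (Equiv.addRight (1 : Fin (n + 2))) fun i => eps (some (e i : V))
  have h3 : (2 • ∑ v ∈ s, eps (some v), s.card) =
      ∑ i, (eps (some (e i : V)) + eps (some (e (i + 1) : V)), 1) := by
    rw [Prod.ext_iff, Prod.fst_sum, Prod.snd_sum]
    refine ⟨?_, by simp [hcard]⟩
    simp only [Finset.sum_add_distrib]
    rw [h2, ← h1, two_nsmul]
  rw [h3]
  refine sum_mem fun i _ => mem_toricMonoid ((mem_latticePoints_stableSetPolytope hG).2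
    ⟨some (e i : V), some (e (i + 1) : V), ?_, rfl⟩)
  have : (SimpleGraph.cycleGraph (n + 2)).Adj i (i + 1) := by
    rw [SimpleGraph.cycleGraph_adj]
    exact Or.inr (by simp)
  exact (SimpleGraph.Iso.map_adj_iff e).2 this

/-- For two disjoint odd holes `C`, `C'` without a bridge, the monomial with exponents
`(ρ(C ∪ C'), (|C| + |C'|) / 2)` is integral over the toric ring but does not belong to it. -/
theorem oddHoleCondition_of_isNormal (hG : G.indepNum = 2) (K : Type*) [Field K]
    (hN : IsNormal K (stableSetPolytope G)) : OddHoleCondition Gᶜ := by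
  classical
  intro s' t' hs' ht' hst'
  by_contra hbridge
  obtain ⟨s, rfl⟩ : ∃ s : Finset V, s' = s := ⟨s'.toFinset, by simp⟩
  obtain ⟨t, rfl⟩ : ∃ t : Finset V, t' = t := ⟨t'.toFinset, by simp⟩
  have hst : Disjoint s t := Finset.disjoint_coe.1 hst'
  have hno : ∀ i ∈ s, ∀ j ∈ t, ¬ Gᶜ.Adj i j := fun i hi j hj hij => hbridge
    ⟨i, ⟨hi, fun h => Finset.disjoint_left.1 hst hi h⟩, j,
      ⟨hj, fun h => Finset.disjoint_left.1 hst h hj⟩, hij⟩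
  obtain ⟨hsodd, hs⟩ := two_smul_mem_of_isOddHole hG hs'
  obtain ⟨htodd, ht⟩ := two_smul_mem_of_isOddHole hG ht'
  obtain ⟨k, hk⟩ := hsodd.add_odd htodd
  set a : V → ℤ := ∑ v ∈ s, eps (some v) + ∑ v ∈ t, eps (some v) with ha
  have hsq : (2 • a, k + k) ∈ toricMonoid (stableSetPolytope G) := by
    have := add_mem hs ht
    rwa [Prod.mk_add_mk, ← smul_add, hk] at this
  have hbig : (a, k + k) ∈ toricMonoid (stableSetPolytope G) := by
    have : ∀ r : Finset V, (∑ v ∈ r, eps (some v), r.card) ∈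
        toricMonoid (stableSetPolytope G) := fun r => by
      have : (∑ v ∈ r, eps (some v), r.card) = ∑ v ∈ r, (eps (some v), 1) := by
        rw [Prod.ext_iff, Prod.fst_sum, Prod.snd_sum]
        simp
      rw [this]
      exact sum_mem fun v _ => mem_toricMonoid (eps_some_mem hG v)
    have := add_mem (this s) (this t)
    rwa [Prod.mk_add_mk, hk] at this
  have hzero : ((0 : V → ℤ), k) ∈ toricMonoid (stableSetPolytope G) := by
    have := nsmul_mem (mem_toricMonoid (zero_mem_latticePoints hG)) k
    simpa using this
  -- The monomial with exponents `(a, k)` is the quotient `p / q`, and its square is `r`.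
  let q : toricRing K (stableSetPolytope G) :=
    ⟨AddMonoidAlgebra.single (0, k) 1, single_mem_toricRing hzero 1⟩
  let p : toricRing K (stableSetPolytope G) :=
    ⟨AddMonoidAlgebra.single (a, k + k) 1, single_mem_toricRing hbig 1⟩
  let r : toricRing K (stableSetPolytope G) :=
    ⟨AddMonoidAlgebra.single (2 • a, k + k) 1, single_mem_toricRing hsq 1⟩
  have hpq : q ^ 2 ∣ p ^ 2 := ⟨r, Subtype.ext (by
    simp only [q, p, r, MulMemClass.coe_mul, sq,
      AddMonoidAlgebra.single_mul_single, Prod.mk_add_mk, mul_one]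
    rw [two_nsmul, zero_add, zero_add])⟩
  have : IsIntegrallyClosed (toricRing K (stableSetPolytope G)) := hN
  obtain ⟨z, hz⟩ := (IsIntegrallyClosed.pow_dvd_pow_iff two_ne_zero).1 hpq
  have hz' : (z : AddMonoidAlgebra K ((V → ℤ) × ℕ)) = AddMonoidAlgebra.single (a, k) 1 := by
    have h1 : (AddMonoidAlgebra.single ((0 : V → ℤ), k) (1 : K)) ≠ 0 :=
      AddMonoidAlgebra.single_ne_zero.2 one_ne_zero
    refine mul_left_cancel₀ h1 ?_
    have h2 := congrArg Subtype.val hz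
    rw [MulMemClass.coe_mul] at h2
    rw [← h2, AddMonoidAlgebra.single_mul_single]
    simp [p]
  have hmem : (a, k) ∈ toricMonoid (stableSetPolytope G) := by
    refine mem_toricRing.1 z.2 _ ?_
    rw [hz', AddMonoidAlgebra.coeff_single, Finsupp.single_eq_same]
    exact one_ne_zero
  have hsum : ∀ r : Finset V, ∑ v ∈ r, a v = (r ∩ s).card + (r ∩ t).card := fun r => by
    rw [ha]
    simp only [Pi.add_apply, Finset.sum_apply, Finset.sum_add_distrib]
    rw [Finset.sum_comm, Finset.sum_comm (s := r) (t := t)]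
    simp [sum_eps_some, Finset.inter_comm]
  have heven := (even_of_mem_toricMonoid hG hst hno hmem).2.2 ?_ ?_
  · rw [hsum, Finset.inter_self, Finset.disjoint_iff_inter_eq_empty.1 hst] at heven
    simp only [Finset.card_empty, Nat.cast_zero, add_zero] at heven
    exact (Nat.not_even_iff_odd.2 hsodd) (by exact_mod_cast heven)
  · have := hsum Finset.univ
    rw [Finset.univ_inter, Finset.univ_inter] at this
    rw [this]
    exact_mod_cast hk.trans (two_mul k).symm
  · intro v hvs hvt
    have := hsum {v}
    rwa [Finset.sum_singleton, Finset.singleton_inter_of_notMem hvs,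
      Finset.singleton_inter_of_notMem hvt] at this

/-- The edge polytope of `Gᶜ` is the face `∑ x = 2` of the stable set polytope. -/
theorem mem_toricMonoid_edgePolytope (hG : G.indepNum = 2) {m : (V → ℤ) × ℕ}
    (hm : m ∈ toricMonoid (stableSetPolytope G)) :
    ∑ v, m.1 v ≤ 2 * m.2 ∧ (∑ v, m.1 v = 2 * m.2 → m ∈ toricMonoid (edgePolytope Gᶜ)) := by
  induction hm using AddSubmonoid.closure_induction with
  | mem x hx =>
    obtain ⟨a, ha, rfl⟩ := hx
    obtain ⟨u, w, huw, rfl⟩ := (mem_latticePoints_stableSetPolytope hG).1 ha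
    match u, w, huw with
    | none, none, _ => simp
    | none, some v, _ => simp [sum_univ_eps_some]
    | some v, none, _ => simp [sum_univ_eps_some]
    | some v, some w, h =>
      refine ⟨by simp [Finset.sum_add_distrib, sum_univ_eps_some], fun _ => ?_⟩
      exact mem_toricMonoid (mem_latticePoints_edgePolytope.2 ⟨v, w, h, rfl⟩)
  | zero => exact ⟨by simp, fun _ => zero_mem _⟩
  | add x y _ _ hx hy =>
    obtain ⟨hx1, hx2⟩ := hx
    obtain ⟨hy1, hy2⟩ := hy
    simp only [Prod.fst_add, Prod.snd_add, Pi.add_apply, Finset.sum_add_distrib]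
    push_cast
    exact ⟨by linarith, fun h => add_mem (hx2 (by linarith)) (hy2 (by linarith))⟩

theorem isNormal_edgePolytope (hG : G.indepNum = 2) (K : Type*) [Field K]
    (hN : IsNormal K (stableSetPolytope G)) : IsNormal K (edgePolytope Gᶜ) := by
  have hle : toricRing K (edgePolytope Gᶜ) ≤ toricRing K (stableSetPolytope G) := by
    refine Algebra.adjoin_mono (Set.image_mono fun a ha => ?_)
    obtain ⟨v, w, hvw, rfl⟩ := mem_latticePoints_edgePolytope.1 ha
    exact (mem_latticePoints_stableSetPolytope hG).2 ⟨some v, some w, hvw, rfl⟩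
  have : IsIntegrallyClosed (toricRing K (stableSetPolytope G)) := hN
  refine isIntegrallyClosed_of_le hle fun f hfB hf => mem_toricRing.2 fun m hm => ?_
  obtain ⟨h1, h2⟩ := mem_toricMonoid_edgePolytope hG (mem_toricRing.1 hfB m hm)
  refine h2 (le_antisymm h1 ?_)
  -- The weight `2 k - ∑ a` vanishes on the face, so it is nonpositive on `f`.
  let D : (V → ℤ) × ℕ →+ ℝ := AddMonoidHom.mk' (fun m => ((2 * m.2 - ∑ v, m.1 v : ℤ) : ℝ))
    fun x y => by
      simp only [Prod.fst_add, Prod.snd_add, Pi.add_apply, Finset.sum_add_distrib]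
      push_cast
      ring
  have hD : ∀ a ∈ latticePoints (edgePolytope Gᶜ), D (a, 1) ≤ 0 := fun a ha => by
    obtain ⟨v, w, hvw, rfl⟩ := mem_latticePoints_edgePolytope.1 ha
    have h : (2 * ((1 : ℕ) : ℤ) - ∑ x, (eps (some v) + eps (some w)) x) ≤ 0 := by
      simp [Finset.sum_add_distrib, sum_univ_eps_some]
    have h' := Int.cast_nonpos (R := ℝ).2 h
    exact h'
  have h3 : ((2 * m.2 - ∑ v, m.1 v : ℤ) : ℝ) ≤ 0 := WeightLE.of_isIntegral (D := D)
    (fun r hr m hm => nonpos_of_mem_toricMonoid hD (mem_toricRing.1 hr m hm)) hf m hm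
  have h4 : (2 * m.2 - ∑ v, m.1 v : ℤ) ≤ 0 := by exact_mod_cast h3
  linarith

end OddHoles

/-! ### Exchange in a simplex of maximal lattice -/

section Exchange

variable {V : Type*}

theorem mem_homLattice {S : Set (V → ℤ)} {a : V → ℤ} (ha : a ∈ S) : (a, (1 : ℤ)) ∈ homLattice S :=
  AddSubgroup.subset_closure ⟨a, ha, rfl⟩

theorem homLattice_mono {S S' : Set (V → ℤ)} (h : S ⊆ S') : homLattice S ≤ homLattice S' :=
  AddSubgroup.closure_mono (Set.image_mono h)

theorem prodToReal_mem_span {S : Set (V → ℤ)} {y : (V → ℤ) × ℤ} (hy : y ∈ homLattice S) :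
    prodToReal y ∈ Submodule.span ℝ (homPoint '' S) := by
  induction hy using AddSubgroup.closure_induction with
  | mem x hx =>
    obtain ⟨a, ha, rfl⟩ := hx
    refine Submodule.subset_span ⟨a, ha, ?_⟩
    rw [prodToReal_apply, Int.cast_one, homPoint]
  | zero => simp
  | add x y _ _ hx hy => rw [map_add]; exact add_mem hx hy
  | neg x _ hx => rw [map_neg]; exact neg_mem hx

/-- If `2 b` is an integral combination of the vertices of a simplex with coefficients at most
`1`, then `b` can replace a vertex of coefficient `1` so that a given point of the simplex stays
inside. As the replaced vertex is an integral combination of the new ones, the lattice grows. -/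
theorem exists_exchange {T : Finset (V → ℤ)} (hT : LinearIndepOn ℝ homPoint (T : Set (V → ℤ)))
    {x : V → ℝ} (hx : x ∈ convexHull ℝ (toReal '' (T : Set (V → ℤ)))) {b : V → ℤ}
    {c : (V → ℤ) → ℤ} (hc : ∀ t ∈ T, c t ≤ 1)
    (hsum : ∑ t ∈ T, c t • (t, (1 : ℤ)) = (2 : ℤ) • (b, (1 : ℤ)))
    (hb : (b, (1 : ℤ)) ∉ homLattice (T : Set (V → ℤ))) :
    ∃ T' : Finset (V → ℤ), (∀ t ∈ T', t = b ∨ t ∈ T) ∧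
      LinearIndepOn ℝ homPoint (T' : Set (V → ℤ)) ∧
      x ∈ convexHull ℝ (toReal '' (T' : Set (V → ℤ))) ∧
      homLattice (T : Set (V → ℤ)) < homLattice (T' : Set (V → ℤ)) := by
  classical
  obtain ⟨l, hl, hlx⟩ := mem_convexHull_toReal_iff.1 hx
  have hsum2 : ∑ t ∈ T, c t = 2 := by
    have := congrArg Prod.snd hsum
    simpa [Prod.snd_sum] using this
  have hne : (T.filter fun t => c t = 1).Nonempty := by
    by_contra hcon
    rw [Finset.not_nonempty_iff_eq_empty, Finset.filter_eq_empty_iff] at hcon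
    have : ∑ t ∈ T, c t ≤ 0 := Finset.sum_nonpos fun t ht => by
      have h1 := hc t ht
      have h2 := hcon ht
      omega
    omega
  -- Moving the weights along `2 b - ∑ c t • t`, the coefficients with `c t = 1` are the only ones
  -- to decrease, and the smallest of them vanishes first.
  obtain ⟨t₀, ht₀, hmin⟩ := Finset.exists_min_image _ l hne
  obtain ⟨ht₀T, hct₀⟩ := Finset.mem_filter.1 ht₀
  have hsumR : ∑ t ∈ T, (c t : ℝ) • homPoint t = (2 : ℝ) • homPoint b := by
    have := congrArg prodToReal hsum
    rw [map_sum, prodToReal_smul_one] at this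
    simp only [prodToReal_smul_one] at this
    exact_mod_cast this
  have hbT : b ∉ T := fun h => hb (mem_homLattice h)
  have hbE : b ∉ T.erase t₀ := fun h => hbT (Finset.mem_of_mem_erase h)
  refine ⟨insert b (T.erase t₀), fun t ht => ?_, ?_, ?_, ?_⟩
  · exact (Finset.mem_insert.1 ht).imp_right Finset.mem_of_mem_erase
  · rw [Finset.coe_insert, Finset.coe_erase]
    refine (hT.mono Set.sdiff_subset).insert fun hspan => ?_
    refine hT.notMem_span ht₀T ?_
    rw [← Finset.add_sum_erase T _ ht₀T, hct₀, Int.cast_one, one_smul] at hsumR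
    rw [eq_sub_of_add_eq hsumR]
    refine sub_mem (Submodule.smul_mem _ _ hspan) (sum_mem fun t ht => Submodule.smul_mem _ _ ?_)
    exact Submodule.subset_span ⟨t, by simpa [and_comm] using Finset.mem_erase.1 ht, rfl⟩
  · refine mem_convexHull_toReal_iff.2
      ⟨fun t => if t = b then 2 * l t₀ else l t - l t₀ * c t, fun t ht => ?_, ?_⟩
    · have h0 : 0 ≤ l t₀ := hl t₀ ht₀T
      by_cases h : t = b
      · simp only [h, if_true]
        positivity
      · have htT : t ∈ T := Finset.mem_of_mem_erase ((Finset.mem_insert.1 ht).resolve_left h)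
        have h1 := hl t htT
        simp only [h, if_false]
        rcases (hc t htT).lt_or_eq with h2 | h2
        · have h3 : (c t : ℝ) ≤ 0 := by exact_mod_cast (by omega : c t ≤ 0)
          nlinarith
        · have := hmin t (Finset.mem_filter.2 ⟨htT, h2⟩)
          rw [h2]
          push_cast
          linarith
    · rw [Finset.sum_insert hbE]
      simp only [if_true]
      have h1 : ∑ t ∈ T.erase t₀, (if t = b then 2 * l t₀ else l t - l t₀ * c t) • homPoint t =
          ∑ t ∈ T, (l t - l t₀ * c t) • homPoint t := by
        rw [← Finset.add_sum_erase T _ ht₀T, hct₀]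
        simp only [Int.cast_one, mul_one, sub_self, zero_smul, zero_add]
        exact Finset.sum_congr rfl fun t ht => by
          have htb : t ≠ b := ne_of_mem_of_not_mem ht hbE
          rw [if_neg htb]
      rw [h1]
      simp only [sub_smul, mul_smul, Finset.sum_sub_distrib, ← Finset.smul_sum, hlx, hsumR]
      rw [smul_comm]
      abel
  · have hb' : (b, (1 : ℤ)) ∈ homLattice ((insert b (T.erase t₀) : Finset _) : Set (V → ℤ)) :=
      mem_homLattice (by simp)
    refine lt_of_le_of_ne ?_ fun h => hb (h ▸ hb')
    refine (AddSubgroup.closure_le _).2 ?_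
    rintro _ ⟨t, ht, rfl⟩
    by_cases h : t = t₀
    · subst h
      rw [← Finset.add_sum_erase T _ ht₀T, hct₀, one_smul] at hsum
      beta_reduce
      rw [SetLike.mem_coe, eq_sub_of_add_eq hsum]
      refine sub_mem (zsmul_mem hb' _) (sum_mem fun s hs => zsmul_mem (mem_homLattice ?_) _)
      exact Finset.mem_coe.2 (Finset.mem_insert_of_mem hs)
    · exact mem_homLattice (Finset.mem_coe.2
        (Finset.mem_insert_of_mem (Finset.mem_erase.2 ⟨h, ht⟩)))

/-- Every point of a lattice polytope lies in a lattice simplex that admits no exchange and whose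
homogenization spans all lattice points. -/
theorem exists_maximal_simplex {L : Set (V → ℤ)} (hL : L.Finite) {x : V → ℝ}
    (hx : x ∈ convexHull ℝ (toReal '' L)) :
    ∃ T : Finset (V → ℤ), (T : Set (V → ℤ)) ⊆ L ∧
      LinearIndepOn ℝ homPoint (T : Set (V → ℤ)) ∧
      x ∈ convexHull ℝ (toReal '' (T : Set (V → ℤ))) ∧
      (∀ b ∈ L, homPoint b ∈ Submodule.span ℝ (homPoint '' (T : Set (V → ℤ)))) ∧
      ∀ b ∈ L, ∀ c : (V → ℤ) → ℤ, (∀ t ∈ T, c t ≤ 1) →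
        ∑ t ∈ T, c t • (t, (1 : ℤ)) = (2 : ℤ) • (b, (1 : ℤ)) →
        (b, (1 : ℤ)) ∈ homLattice (T : Set (V → ℤ)) := by
  classical
  set F : Set (Finset (V → ℤ)) := {T | (T : Set (V → ℤ)) ⊆ L ∧
      LinearIndepOn ℝ homPoint (T : Set (V → ℤ)) ∧
      x ∈ convexHull ℝ (toReal '' (T : Set (V → ℤ)))} with hF
  have hfin : F.Finite := by
    refine (hL.toFinset.powerset.finite_toSet).subset fun T hT => ?_
    rw [Finset.mem_coe, Finset.mem_powerset]
    intro t ht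
    simpa using hT.1 ht
  have hne : F.Nonempty := by
    rw [convexHull_eq_union] at hx
    simp only [Set.mem_iUnion] at hx
    obtain ⟨S, hS, hind, hxS⟩ := hx
    obtain ⟨T, hTL, rfl⟩ := Finset.subset_set_image_iff.1 hS
    rw [Finset.coe_image] at hxS
    refine ⟨T, hTL, linearIndepOn_homPoint_iff.2 ?_, hxS⟩
    let e : T ↪ (T.image toReal : Finset (V → ℝ)) :=
      ⟨fun t => ⟨toReal (t : V → ℤ), Finset.mem_image_of_mem _ t.2⟩, fun s t h =>
        Subtype.ext (toReal_injective (congrArg Subtype.val h))⟩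
    exact hind.comp_embedding e
  obtain ⟨T, hT, hmax⟩ := hfin.exists_maximalFor
    (fun T : Finset (V → ℤ) => homLattice (T : Set (V → ℤ))) F hne
  refine ⟨T, hT.1, hT.2.1, hT.2.2, fun b hb => ?_, fun b hb c hc hsum => ?_⟩
  · by_contra hspan
    have hmem : insert b T ∈ F := by
      refine ⟨?_, ?_, ?_⟩
      · rw [Finset.coe_insert]
        exact Set.insert_subset hb hT.1
      · rw [Finset.coe_insert]
        exact hT.2.1.insert hspan
      · refine convexHull_mono (Set.image_mono ?_) hT.2.2
        simp
    have h1 := hmax hmem (homLattice_mono (by simp))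
    have h2 := prodToReal_mem_span (h1 (mem_homLattice (a := b) (by simp)))
    rw [prodToReal_apply, Int.cast_one] at h2
    exact hspan h2
  · by_contra hnot
    obtain ⟨T', hT', hind, hxT', hlt⟩ := exists_exchange hT.2.1 hT.2.2 hc hsum hnot
    refine hlt.not_ge (hmax ⟨fun t ht => ?_, hind, hxT'⟩ hlt.le)
    rcases hT' t ht with rfl | h
    · exact hb
    · exact hT.1 h

end Exchange

/-! ### Simplices as graphs on the cone -/

section Structure

variable {V : Type*} [Fintype V]

/-- The linear form on `S^V × S` whose value at `(eps u + eps w, 1)` is `f u + f w`. -/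
def pairing {S : Type*} [CommRing S] (f : Option V → S) : (V → S) × S →ₗ[S] S where
  toFun y := ∑ v, y.1 v * (f (some v) - f none) + 2 * y.2 * f none
  map_add' x y := by
    simp only [Prod.fst_add, Prod.snd_add, Pi.add_apply, add_mul, Finset.sum_add_distrib, mul_add]
    ring
  map_smul' r x := by
    simp only [Prod.smul_fst, Prod.smul_snd, Pi.smul_apply, smul_eq_mul, RingHom.id_apply,
      mul_add, Finset.mul_sum]
    congr 1
    · exact Finset.sum_congr rfl fun v _ => by ring
    · ring

theorem pairing_eps (f : Option V → ℤ) (u w : Option V) :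
    pairing f (eps u + eps w, 1) = f u + f w := by
  classical
  have key : ∀ u : Option V, ∑ v, eps u v * (f (some v) - f none) = f u - f none := by
    intro u
    cases u <;> simp [eps]
  simp only [pairing, LinearMap.coe_mk, AddHom.coe_mk, Pi.add_apply, add_mul,
    Finset.sum_add_distrib, key]
  ring

theorem pairing_prodToReal (f : Option V → ℤ) (y : (V → ℤ) × ℤ) :
    pairing (fun u => (f u : ℝ)) (prodToReal y) = ((pairing f y : ℤ) : ℝ) := by
  obtain ⟨a, k⟩ := y
  simp [pairing, prodToReal_apply, toReal]

omit [Fintype V] in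
theorem eps_injective : Function.Injective (eps : Option V → V → ℤ) := by
  classical
  intro u w h
  cases u with
  | none =>
    cases w with
    | none => rfl
    | some w => simpa [eps] using congrFun h w
  | some u =>
    have := congrFun h u
    simp only [eps, if_true] at this
    by_contra hne
    rw [if_neg (Ne.symm hne)] at this
    omega

theorem eps_add_eps_eq {u w u' w' : Option V} (h : eps u + eps w = eps u' + eps w') :
    (u = u' ∧ w = w') ∨ (u = w' ∧ w = u') := by
  classical
  have h1 := pairing_eps (fun z => if z = u then 1 else 0) u w
  rw [h, pairing_eps, if_pos rfl] at h1
  have h2 : u' = u ∨ w' = u := by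
    by_contra hcon
    push Not at hcon
    rw [if_neg hcon.1, if_neg hcon.2] at h1
    split_ifs at h1 <;> omega
  rcases h2 with rfl | rfl
  · exact Or.inl ⟨rfl, eps_injective (add_left_cancel h)⟩
  · rw [add_comm (eps u')] at h
    exact Or.inr ⟨rfl, eps_injective (add_left_cancel h)⟩

/-- The graph on the cone whose edges are the vertices of the simplex `T`. -/
def simplexAdj (T : Finset (V → ℤ)) (u w : Option V) : Prop := eps u + eps w ∈ T

variable {T : Finset (V → ℤ)}

omit [Fintype V] in
theorem simplexAdj_symm (u w : Option V) (h : simplexAdj T u w) : simplexAdj T w u := by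
  rw [simplexAdj, add_comm]
  exact h

omit [Fintype V] in
theorem alternating_sum_edges (c : ℕ → Option V) (m : ℕ) :
    ∑ j ∈ Finset.range (2 * m + 1), (-1 : ℤ) ^ j • (eps (c j) + eps (c (j + 1)), (1 : ℤ)) =
      (eps (c 0) + eps (c (2 * m + 1)), 1) := by
  induction m with
  | zero => simp
  | succ m ih =>
    rw [show 2 * (m + 1) + 1 = 2 * m + 1 + 1 + 1 by ring, Finset.sum_range_succ,
      Finset.sum_range_succ, ih]
    have h1 : (-1 : ℤ) ^ (2 * m + 1) = -1 := Odd.neg_one_pow ⟨m, rfl⟩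
    have h2 : (-1 : ℤ) ^ (2 * m + 1 + 1) = 1 := Even.neg_one_pow ⟨m + 1, by ring⟩
    rw [h1, h2, neg_one_smul, one_smul, Prod.ext_iff]
    refine ⟨?_, by simp⟩
    simp only [Prod.fst_add, Prod.fst_neg]
    abel

/-- Along an odd cycle of `T` through `c i`, the alternating sum of the edges is `2 e_{c i}`. The
edges are distinct, so their coefficients are at most `1`. -/
theorem IsInducedOddWalk.exists_coeff {k : ℕ} {c : ℕ → Option V}
    (hc : IsInducedOddWalk (simplexAdj T) k c) (i : ℕ) :
    ∃ l : (V → ℤ) → ℤ, (∀ t, l t ≤ 1) ∧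
      (∀ t, l t ≠ 0 → ∃ j, t = eps (c j) + eps (c (j + 1))) ∧
      ∑ t ∈ T, l t • (t, (1 : ℤ)) = (eps (c i) + eps (c i), (1 : ℤ)) := by
  classical
  have hd := hc.shift i
  set d : ℕ → Option V := fun j => c (i + j) with hddef
  have hedge : ∀ j < k, ∀ j' < k,
      eps (d j) + eps (d (j + 1)) = eps (d j') + eps (d (j' + 1)) → j = j' := by
    intro j hj j' hj' h
    rcases eps_add_eps_eq h with ⟨h1, -⟩ | ⟨h1, h2⟩
    · exact Nat.ModEq.eq_of_lt_of_lt (hd.inj _ _ h1) hj hj'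
    -- An edge traversed in both directions would give `2 ≡ 0` modulo the odd number `k`.
    · have h3 := hd.inj _ _ h1
      have h4 := (hd.inj _ _ h2).symm
      have h5 : j + 2 ≡ j + 0 [MOD k] := ((h4.add_right 1).symm.trans h3.symm)
      have h6 : k ∣ 2 := (Nat.modEq_zero_iff_dvd).1 (Nat.ModEq.add_left_cancel' j h5)
      have h7 := Nat.le_of_dvd two_pos h6
      have h8 := hc.odd
      obtain rfl : k = 1 := by
        interval_cases k
        · simp at h8
        · rfl
        · exact absurd h8 (by decide)
      omega
  refine ⟨fun t => ∑ j ∈ Finset.range k,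
    if t = eps (d j) + eps (d (j + 1)) then (-1 : ℤ) ^ j else 0, fun t => ?_, fun t ht => ?_, ?_⟩
  · beta_reduce
    by_cases h : ∃ j ∈ Finset.range k, t = eps (d j) + eps (d (j + 1))
    · obtain ⟨j, hj, rfl⟩ := h
      rw [Finset.sum_eq_single j]
      · rw [if_pos rfl]
        rcases neg_one_pow_eq_or ℤ j with h | h <;> norm_num [h]
      · intro j' hj' hne
        exact if_neg fun h => hne (hedge j (Finset.mem_range.1 hj) j' (Finset.mem_range.1 hj') h).symm
      · exact fun h => absurd hj h
    · rw [Finset.sum_eq_zero fun j hj => if_neg fun h' => h ⟨j, hj, h'⟩]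
      exact zero_le_one
  · obtain ⟨j, -, hj⟩ := Finset.exists_ne_zero_of_sum_ne_zero ht
    exact ⟨i + j, of_not_not fun h => hj (if_neg h)⟩
  · have h1 : ∀ t : V → ℤ, (∑ j ∈ Finset.range k,
        if t = eps (d j) + eps (d (j + 1)) then (-1 : ℤ) ^ j else 0) • (t, (1 : ℤ)) =
        ∑ j ∈ Finset.range k, if t = eps (d j) + eps (d (j + 1)) then
          (-1 : ℤ) ^ j • (eps (d j) + eps (d (j + 1)), (1 : ℤ)) else 0 := by
      intro t
      rw [Finset.sum_smul]
      refine Finset.sum_congr rfl fun j _ => ?_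
      split_ifs with h
      · rw [h]
      · rw [zero_smul]
    simp only [h1]
    rw [Finset.sum_comm]
    have h2 : ∀ j, eps (d j) + eps (d (j + 1)) ∈ T := hd.step
    simp only [Finset.sum_ite_eq', h2, if_true]
    obtain ⟨m, rfl⟩ := hc.odd
    rw [alternating_sum_edges]
    have h3 := hd.periodic 0
    rw [zero_add] at h3
    rw [h3]
    rfl

omit [Fintype V] in
/-- The edges of `T` along a walk from `u` to `w` generate `e_u + e_w` or `e_u - e_w`, according
to the parity of the walk. -/
theorem HasWalk.mem_homLattice {n : ℕ} {u w : Option V} (h : HasWalk (simplexAdj T) n u w) :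
    (Odd n → (eps u + eps w, (1 : ℤ)) ∈ homLattice (T : Set (V → ℤ))) ∧
      (Even n → (eps u - eps w, (0 : ℤ)) ∈ homLattice (T : Set (V → ℤ))) := by
  obtain ⟨c, rfl, rfl, hc⟩ := h
  induction n with
  | zero => exact ⟨fun h => by simp at h, fun _ => by rw [sub_self]; exact zero_mem _⟩
  | succ n ih =>
    obtain ⟨h1, h2⟩ := ih fun i hi => hc i (by omega)
    have h3 : (eps (c n) + eps (c (n + 1)), (1 : ℤ)) ∈ homLattice (T : Set (V → ℤ)) :=
      StabPoly.mem_homLattice (hc n (by omega))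
    constructor
    · intro hn
      have h4 := add_mem (h2 (by grind)) h3
      rw [Prod.mk_add_mk, zero_add] at h4
      convert h4 using 2
      abel
    · intro hn
      have h4 := sub_mem (h1 (by grind)) h3
      rw [Prod.mk_sub_mk, sub_self] at h4
      convert h4 using 2
      abel

variable {G : SimpleGraph V}

/-- A simplex spanning all lattice points has an odd closed walk in each component: otherwise the
signs of a bipartition of a component would give a linear form vanishing on the simplex. -/
theorem exists_odd_closed_walk (hG : G.indepNum = 2)
    (hspan : ∀ b ∈ latticePoints (stableSetPolytope G),
      homPoint b ∈ Submodule.span ℝ (homPoint '' (T : Set (V → ℤ))))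
    (hT : (T : Set (V → ℤ)) ⊆ latticePoints (stableSetPolytope G)) (u : Option V) :
    ∃ k, Odd k ∧ HasWalk (simplexAdj T) k u u := by
  by_contra hcon
  push Not at hcon
  obtain ⟨f, hfu, hf⟩ := exists_sign_of_forall_not_odd simplexAdj_symm u hcon
  have hval : ∀ v w, pairing (fun u => (f u : ℝ)) (homPoint (eps v + eps w)) = (f v + f w : ℤ) :=
    fun v w => by
      rw [← pairing_eps, ← pairing_prodToReal, prodToReal_apply, Int.cast_one, homPoint]
  have hker : Submodule.span ℝ (homPoint '' (T : Set (V → ℤ))) ≤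
      LinearMap.ker (pairing fun u => (f u : ℝ)) := by
    rw [Submodule.span_le]
    rintro _ ⟨t, ht, rfl⟩
    obtain ⟨v, w, -, rfl⟩ := (mem_latticePoints_stableSetPolytope hG).1 (hT ht)
    rw [SetLike.mem_coe, LinearMap.mem_ker, hval, hf v w ht, Int.cast_zero]
  have hzero : ∀ v w, ConeAdj Gᶜ v w → f v + f w = 0 := fun v w hvw => by
    have h1 := hker (hspan _ ((mem_latticePoints_stableSetPolytope hG).2 ⟨v, w, hvw, rfl⟩))
    rw [LinearMap.mem_ker, hval] at h1
    exact_mod_cast h1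
  have h1 := hzero none none trivial
  have h2 := hzero none u trivial
  omega

/-- Odd cycles of two components of `T` are joined by an edge of the cone over the complement:
the apex is adjacent to everything, and away from it both contain induced odd cycles. -/
theorem exists_coneAdj_of_disjoint (hG : G.indepNum = 2) (hcond : OddCycleCondition Gᶜ)
    (hT : (T : Set (V → ℤ)) ⊆ latticePoints (stableSetPolytope G))
    {k k' : ℕ} {c c' : ℕ → Option V} (hc : IsInducedOddWalk (simplexAdj T) k c)
    (hc' : IsInducedOddWalk (simplexAdj T) k' c') (hne : ∀ i j, c i ≠ c' j) :
    ∃ i j, ConeAdj Gᶜ (c i) (c' j) := by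
  have hadj : ∀ u w, simplexAdj T u w → ConeAdj Gᶜ u w := fun u w h => by
    obtain ⟨u', w', h1, h2⟩ := (mem_latticePoints_stableSetPolytope hG).1 (hT h)
    rcases eps_add_eps_eq h2 with ⟨rfl, rfl⟩ | ⟨rfl, rfl⟩
    · exact h1
    · exact h1.symm
  have hcycle : ∀ {k : ℕ} {c : ℕ → Option V}, IsInducedOddWalk (simplexAdj T) k c →
      (∀ i, c i ≠ none) → ∃ s : Set V, IsInducedOddCycle Gᶜ s ∧ ∀ v ∈ s, ∃ i, c i = some v := by
    intro k c hc hnone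
    choose d hd using fun i => Option.ne_none_iff_exists'.1 (hnone i)
    obtain ⟨s, hs, hs'⟩ := exists_isInducedOddCycle_subset_range (H := Gᶜ) (d := d) hc.odd
      (by
        have := hc.periodic 0
        rw [zero_add, hd, hd] at this
        exact Option.some_injective _ this)
      (fun i _ => by
        have := hadj _ _ (hc.step i)
        rwa [hd, hd] at this)
    refine ⟨s, hs', fun v hv => ?_⟩
    obtain ⟨i, rfl⟩ := hs hv
    exact ⟨i, hd i⟩
  by_cases h1 : ∃ i, c i = none
  · obtain ⟨i, hi⟩ := h1
    exact ⟨i, 0, by rw [hi]; trivial⟩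
  by_cases h2 : ∃ j, c' j = none
  · obtain ⟨j, hj⟩ := h2
    exact ⟨0, j, by rw [hj]; exact ConeAdj.symm trivial⟩
  push Not at h1 h2
  obtain ⟨s, hs, hsc⟩ := hcycle hc h1
  obtain ⟨t, ht, htc⟩ := hcycle hc' h2
  rcases hcond s t hs ht with ⟨v, hvs, hvt⟩ | ⟨v, hv, w, hw, hvw⟩
  · obtain ⟨i, hi⟩ := hsc v hvs
    obtain ⟨j, hj⟩ := htc v hvt
    exact absurd (hi.trans hj.symm) (hne i j)
  · obtain ⟨i, hi⟩ := hsc v hv.1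
    obtain ⟨j, hj⟩ := htc w hw.1
    exact ⟨i, j, by rw [hi, hj]; exact hvw⟩

/-- A simplex that spans all lattice points and admits no exchange is unimodular. If its graph is
connected, its odd cycle gives all `e_u + e_w`. Otherwise a bridge `b` between odd cycles of two
components has `2 b` an alternating sum of the edges of these cycles, while `b` itself is not in
the lattice, whose vectors have even sum over each component. -/
theorem homLattice_eq_of_maximal (hG : G.indepNum = 2) (hcond : OddCycleCondition Gᶜ)
    (hT : (T : Set (V → ℤ)) ⊆ latticePoints (stableSetPolytope G))
    (hspan : ∀ b ∈ latticePoints (stableSetPolytope G),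
      homPoint b ∈ Submodule.span ℝ (homPoint '' (T : Set (V → ℤ))))
    (hmax : ∀ b ∈ latticePoints (stableSetPolytope G), ∀ c : (V → ℤ) → ℤ, (∀ t ∈ T, c t ≤ 1) →
        ∑ t ∈ T, c t • (t, (1 : ℤ)) = (2 : ℤ) • (b, (1 : ℤ)) →
        (b, (1 : ℤ)) ∈ homLattice (T : Set (V → ℤ))) :
    homLattice (T : Set (V → ℤ)) = homLattice (latticePoints (stableSetPolytope G)) := by
  classical
  have hodd := exists_odd_closed_walk hG hspan hT
  by_cases hconn : ∀ u w, ∃ n, HasWalk (simplexAdj T) n u w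
  · refine le_antisymm (homLattice_mono hT) ((AddSubgroup.closure_le _).2 ?_)
    rintro _ ⟨t, ht, rfl⟩
    obtain ⟨u, w, -, rfl⟩ := (mem_latticePoints_stableSetPolytope hG).1 ht
    obtain ⟨n, hn⟩ := hconn u w
    obtain ⟨k, hk, hw⟩ := hodd w
    rcases Nat.even_or_odd n with h | h
    · exact (hn.trans hw).mem_homLattice.1 (h.add_odd hk)
    · exact hn.mem_homLattice.1 h
  · exfalso
    push Not at hconn
    obtain ⟨u, w, huw⟩ := hconn
    obtain ⟨k₁, hk₁, hw₁⟩ := hodd u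
    obtain ⟨k₂, hk₂, hw₂⟩ := hodd w
    obtain ⟨k, c, hc, hcu⟩ := exists_isInducedOddWalk simplexAdj_symm hk₁ hw₁
    obtain ⟨k', c', hc', hcw⟩ := exists_isInducedOddWalk simplexAdj_symm hk₂ hw₂
    have hsep : ∀ j, ¬ ∃ n, HasWalk (simplexAdj T) n u (c' j) := by
      rintro j ⟨n, hn⟩
      obtain ⟨m, hm⟩ := hcw j
      exact huw _ (hn.trans (hm.symm simplexAdj_symm))
    have hne : ∀ i j, c i ≠ c' j := fun i j h => hsep j (h ▸ hcu i)
    obtain ⟨i, j, hij⟩ := exists_coneAdj_of_disjoint hG hcond hT hc hc' hne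
    obtain ⟨l, hl1, hl2, hl3⟩ := hc.exists_coeff i
    obtain ⟨l', hl1', hl2', hl3'⟩ := hc'.exists_coeff j
    have hb := hmax _ ((mem_latticePoints_stableSetPolytope hG).2 ⟨c i, c' j, hij, rfl⟩)
      (fun t => l t + l' t) (fun t _ => ?_) ?_
    · -- Count the component of `u`: even on the lattice, but `1` on the bridge.
      let f : Option V → ℤ := fun z => if ∃ n, HasWalk (simplexAdj T) n u z then 1 else 0
      have heven : ∀ y ∈ homLattice (T : Set (V → ℤ)), Even (pairing f y) := by
        intro y hy
        induction hy using AddSubgroup.closure_induction with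
        | mem x hx =>
          obtain ⟨t, ht, rfl⟩ := hx
          obtain ⟨v, z, -, rfl⟩ := (mem_latticePoints_stableSetPolytope hG).1 (hT ht)
          have hvz : simplexAdj T v z := ht
          have hiff : (∃ n, HasWalk (simplexAdj T) n u v) ↔ ∃ n, HasWalk (simplexAdj T) n u z :=
            ⟨fun ⟨n, hn⟩ => ⟨n + 1, hn.trans (HasWalk.single hvz)⟩,
              fun ⟨n, hn⟩ => ⟨n + 1, hn.trans (HasWalk.single (simplexAdj_symm _ _ hvz))⟩⟩
          have hfvz : f v = f z := by simp only [f, hiff]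
          rw [pairing_eps, hfvz]
          exact Even.add_self _
        | zero => simp
        | add x y _ _ hx hy => rw [map_add]; exact hx.add hy
        | neg x _ hx => rw [map_neg]; exact hx.neg
      have h1 := heven _ hb
      rw [pairing_eps] at h1
      simp only [f, if_pos (hcu i), if_neg (hsep j)] at h1
      exact absurd h1 (by decide)
    · have h1 := hl1 t
      have h2 := hl1' t
      by_cases h3 : l t = 0
      · rw [h3, zero_add]
        exact h2
      by_cases h4 : l' t = 0
      · rw [h4, add_zero]
        exact h1
      obtain ⟨a, ha⟩ := hl2 t h3
      obtain ⟨b, hb⟩ := hl2' t h4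
      rcases eps_add_eps_eq (ha.symm.trans hb) with ⟨h5, -⟩ | ⟨h5, -⟩
      · exact absurd h5 (hne _ _)
      · exact absurd h5 (hne _ _)
    · simp only [add_smul, Finset.sum_add_distrib, hl3, hl3']
      rw [Prod.ext_iff]
      refine ⟨?_, by simp⟩
      simp only [Prod.fst_add, two_smul]
      abel

theorem hasUnimodularCovering (hG : G.indepNum = 2) (hcond : OddCycleCondition Gᶜ) :
    HasUnimodularCovering (stableSetPolytope G) := by
  classical
  have hfin : (latticePoints (stableSetPolytope G)).Finite :=
    (Set.finite_Icc (0 : V → ℤ) 1).subset fun a ha => nonneg_le_one_of_mem_latticePoints ha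
  have hconv : Convex ℝ (stableSetPolytope G) := convex_convexHull ℝ _
  have hhull : stableSetPolytope G ⊆
      convexHull ℝ (toReal '' latticePoints (stableSetPolytope G)) := by
    refine convexHull_min ?_ (convex_convexHull ℝ _)
    rintro _ ⟨W, hW, rfl⟩
    refine subset_convexHull ℝ _ ⟨W.indicator fun _ => 1, ?_, ?_⟩
    · refine subset_convexHull ℝ _ ⟨W, hW, ?_⟩
      ext v
      by_cases h : v ∈ W <;> simp [toReal, rho, h]
    · ext v
      by_cases h : v ∈ W <;> simp [toReal, rho, h]
  refine ⟨hfin.toFinset.powerset.filter (IsUnimodularSimplex (stableSetPolytope G)),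
    fun S hS => (Finset.mem_filter.1 hS).2, Set.Subset.antisymm (fun x hx => ?_) ?_⟩
  · obtain ⟨T, hTL, hind, hxT, hspan, hmax⟩ := exists_maximal_simplex hfin (hhull hx)
    refine Set.mem_iUnion₂.2 ⟨T, Finset.mem_filter.2 ⟨?_, hTL, ?_, ?_⟩, hxT⟩
    · rw [Finset.mem_powerset]
      intro t ht
      exact hfin.mem_toFinset.2 (hTL ht)
    · exact linearIndepOn_homPoint_iff.1 hind
    · exact homLattice_eq_of_maximal hG hcond hTL hspan hmax
  · refine Set.iUnion₂_subset fun S hS => convexHull_min ?_ hconv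
    rintro _ ⟨t, ht, rfl⟩
    exact (Finset.mem_filter.1 hS).2.subset ht

end Structure

end StabPoly

theorem mainTheorem1 {V : Type*} [Fintype V] (G : SimpleGraph V) (hG : G.indepNum = 2)
    (K : Type*) [Field K] :
    List.TFAE
      [StabPoly.IsNormal K (StabPoly.stableSetPolytope G),
       StabPoly.HasUnimodularCovering (StabPoly.stableSetPolytope G),
       StabPoly.OddCycleCondition Gᶜ,
       StabPoly.OddHoleCondition Gᶜ] ∧
    (StabPoly.IsNormal K (StabPoly.stableSetPolytope G) →
      StabPoly.IsNormal K (StabPoly.edgePolytope Gᶜ)) := by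
  refine ⟨?_, StabPoly.isNormal_edgePolytope hG K⟩
  tfae_have 1 → 4 := StabPoly.oddHoleCondition_of_isNormal hG K
  tfae_have 3 ↔ 4 := StabPoly.oddCycleCondition_iff_oddHoleCondition hG
  tfae_have 3 → 2 := StabPoly.hasUnimodularCovering hG
  tfae_have 2 → 1 := fun h => h.isNormal K (convex_convexHull ℝ _)
    (fun _ ha => StabPoly.nonneg_le_one_of_mem_latticePoints ha)
    (StabPoly.homLattice_stableSetPolytope hG)
  tfae_finish
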